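/- Let $k$ be a field, $G$ a group, $J$ a set, and let $(G,g_i,\chi_i;i\in J)$ be an *element system with characters* (ESC): $g_i\in Z(G)$ and $\chi_i:G\to k^\times$ is a group homomorphism for every $i\in J$. Let $N_i\in\mathbb N\cup\{\infty\}$ be the order of $q_i:=\chi_i(g_i)$, with $N_i=\infty$ if $q_i$ is not a root of unity or $q_i=1$. Assume that the ESC is *quantum weakly commutative*: $\chi_i(g_j)\chi_j(g_i)=1$ for all $i\neq j$ in $J$. Assume moreover that $\operatorname{char}k=0$ in case $\chi_i(g_i)=1$ for some $i\in J$. **The Hopf algebra $H(G,g_i,\chi_i;i\in J)$.** Let $A$ be a Hopf algebra over $k$ such that: (i) $G$ is a subgroup of the group of group-like elements of $A$; (ii) there is a linearly independent family $(X_i)_{i\in J}$ in $A$ such that $A$ is generated as an algebra by $G$ and the $X_i$; (iii) $\Delta(X_j)=X_j\otimes 1+g_j\otimes X_j$ for $j\in J$; (iv) $X_jh=\chi_j(h)\,hX_j$ for $j\in J$, $h\in G$; (v) $X_jX_i=\chi_j(g_i)\,X_iX_j$ for $i\neq j$ in $J$; (vi) $A_{(0)}\cap A_{(1)}=0$, where,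 for $n\ge 0$, $A_{(n)}$ is the span of all products $hX_{i_1}\cdots X_{i_n}$ with $h\in G$ and $i_1,\dots,i_n\in J$ (so $A_{(0)}=kG$). Suppose also that $A$ is graded, with $G$ in degree $0$ and the $X_i$ in degree $1$, that is, $A=\bigoplus_{n\ge 0}A_{(n)}$. Let $J(A)$ be the two-sided ideal of $A$ generated by all $X_i^{N_i}$ with $N_i<\infty$; it is a Hopf ideal. Put $H(G,g_i,\chi_i;i\in J):=A/J(A)$, with the images of the $A_{(n)}$ as its homogeneous components. **The multiple Taft algebra $kG[kQ_1^c,G,g_i,\chi_i;i\in J]$.** Let $Q$ be the quiver with vertex set $G$ and with one arrow $a_{x,i}$ from $x$ to $g_ix$ for all $x\in G$, $i\in J$. Write $(x;i_1,\dots,i_n)$ for the path of length $n$ which starts at the vertex $x$ and runs through arrows with the labels $i_1,\dots,i_n$ in this order; thus $(x;\,)$ is the vertex $x$ and $(x;i)=a_{x,i}$. The *co-path Hopf algebra* $kQ^c$ has all paths as a basis. Its coalgebra structure is $$\Delta(x;i_1,\dots,i_n)=\sum_{l=0}^{n}\,(g_{i_l}\cdots g_{i_1}x;\,i_{l+1},\dots,i_n)\otimes(x;\,i_1,\dots,i_l),$$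 with counit $1$ on vertices and $0$ on longer paths. Its product is the one determined by the $kG$-bimodule structure $h\cdot a_{x,i}=a_{hx,i}$, $a_{x,i}\cdot h=\chi_i(h)\,a_{xh,i}$ on arrows, namely the bilinear product given recursively by $$(x;\,)(y;w)=(xy;w),\qquad (x;i,v)(y;\,)=\chi_i(y)\;i\circ\big((g_ix;v)(y;\,)\big),$$ $$(x;i,v)(y;j,w)=\chi_i(y)\;i\circ\big((g_ix;v)(y;j,w)\big)+j\circ\big((x;i,v)(g_jy;w)\big),$$ where $v,w$ are finite sequences of labels and $i\circ$ is the linear map $(z;u)\mapsto(g_i^{-1}z;i,u)$, which extends a path by an arrow at its start. With these operations $kQ^c$ is a Hopf algebra. The *multiple Taft algebra* $kG[kQ_1^c,G,g_i,\chi_i;i\in J]$ is the subalgebra of $kQ^c$ generated by the vertices and the arrows. It is a Hopf subalgebra, and its homogeneous component of degree $n$ consists of its elements that are linear combinations of paths of length $n$. **Proposition.** Graded Hopf algebras $A$ as above exist; in particular, such an $A$ is given on the algebra presented by generators $h\in G$ and $X_i$ ($i\in J$) with the relations of $G$ and the relations (iv) and (v). For every such $A$, $H(G,g_i,\chi_i;i\in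 J)=A/J(A)$ and the multiple Taft algebra $kG[kQ_1^c,G,g_i,\chi_i;i\in J]$ are $\mathbb N$-graded Hopf algebras with the components above, and they are isomorphic as graded Hopf algebras. -/

import Mathlib

open scoped TensorProduct
open Coalgebra

/-- An element system with characters over the field `k`: a group `G`, a set `J`, central elements
`g i` of `G` and one-dimensional characters `χ i : G → kˣ`, indexed by `i : J`. -/
structure ESC (k G J : Type*) [Field k] [Group G] where
  g : J → G
  χ : J → G →* kˣ
  g_mem_center : ∀ i, g i ∈ Subgroup.center G

namespace ESC

section Basic
variable {k G J : Type*} [Field k] [Group G] (E : ESC k G J)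

/-- The scalar `q i j = χ_j (g_i)`. -/
noncomputable def q (i j : J) : k := (E.χ j (E.g i) : k)

open Classical in
/-- `N i` is the order of `q i i = χ_i (g_i)`, with the convention that it is `∞` when `q i i` is
not a root of unity (`orderOf` is `0` then) or `q i i = 1` (`orderOf` is `1` then). -/
noncomputable def N (i : J) : ℕ∞ := if 1 < orderOf (E.q i i) then (orderOf (E.q i i) : ℕ∞) else ⊤

/-- Quantum weak commutativity: `χ_i (g_j) χ_j (g_i) = 1` for all `i ≠ j`. -/
def IsQuantumWeaklyCommutative : Prop := ∀ i j, i ≠ j → E.χ i (E.g j) * E.χ j (E.g i) = 1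

end Basic

section CoPathSpace
variable {k G J : Type*} [Field k] [Group G] (E : ESC k G J)

/-!
The Hopf quiver of the system has the set of vertices `G` and, for every `x : G` and `i : J`, one
arrow `a_{x,i}` from `x` to `g_i x`. An `n`-path is determined by its start vertex `x` and the
labels `[i_1, ..., i_n]` of its successive arrows: the first arrow is `a_{x,i_1}`, the second one
is `a_{g_{i_1} x, i_2}`, and so on; so its end vertex is `g_{i_n} ⋯ g_{i_1} x`. The arrows span
the `kG`-Hopf bimodule with actions `h • a_{x,i} = a_{hx,i}` and `a_{x,i} • h = χ_i(h) a_{xh,i}`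
and coactions `a_{x,i} ↦ g_i x ⊗ a_{x,i}` and `a_{x,i} ↦ a_{x,i} ⊗ x`.
-/

/-- The underlying vector space of the co-path Hopf algebra `kQᶜ`: it has the paths
of the quiver (including the trivial ones, the vertices) as a basis. -/
def CoPath (_E : ESC k G J) : Type _ := (G × List J) →₀ k

noncomputable instance : AddCommGroup E.CoPath := inferInstanceAs (AddCommGroup ((G × List J) →₀ k))
noncomputable instance : Module k E.CoPath := inferInstanceAs (Module k ((G × List J) →₀ k))

/-- The path with start vertex `x` and successive arrow labels `v`, as a basis vector. The path
`path x []` is the vertex `x`, the path `path x [i]` is the arrow `a_{x,i}`. -/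
noncomputable def path (x : G) (v : List J) : E.CoPath := Finsupp.single (x, v) (1 : k)

/-- The linear map with prescribed values on the paths. -/
noncomputable def lin {M : Type*} [AddCommGroup M] [Module k M] (f : G → List J → M) :
    E.CoPath →ₗ[k] M := Finsupp.linearCombination k (fun p : G × List J => f p.1 p.2)

variable {E}

@[simp] lemma lin_path {M : Type*} [AddCommGroup M] [Module k M] (f : G → List J → M)
    (x : G) (v : List J) : E.lin f (E.path x v) = f x v :=
  (Finsupp.linearCombination_single k (1 : k) (x, v)).trans (one_smul k _)

lemma hom_ext {M : Type*} [AddCommGroup M] [Module k M] {f h : E.CoPath →ₗ[k] M}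
    (H : ∀ x v, f (E.path x v) = h (E.path x v)) : f = h :=
  Finsupp.lhom_ext' fun p => LinearMap.ext_ring (H p.1 p.2)

variable (E)

/-- Extension of paths by an arrow at the start: the path `p` starting at `z` goes to the path which
first follows the arrow with label `i` ending at `z`, and then follows `p`. -/
noncomputable def prep (i : J) : E.CoPath →ₗ[k] E.CoPath :=
  E.lin fun z v => E.path ((E.g i)⁻¹ * z) (i :: v)

/-- The linear map scaling every path starting at `z` by `χ_i (z)`. -/
noncomputable def tw (i : J) : E.CoPath →ₗ[k] E.CoPath :=
  E.lin fun z v => (E.χ i z : k) • E.path z v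

/-- The product of two paths in the co-path Hopf algebra, i.e. in the cotensor coalgebra of the Hopf
bimodule of arrows. The product of paths `A` and `B` of lengths `n` and `m` is the sum over all
pairs of complementary thin splits `d A` and `d' B` of length `n + m` (in each position one of the
two carries its next arrow and the other one its current vertex) of the path whose arrow in each
position is the product of the entries of `d A` and `d' B` there, formed with the left and
right actions of `G` on the arrows. The recursion is on the first position: either the
first arrow `a_{x,i}` of `A` is multiplied from the right by the start vertex `y` of `B`, which gives
`χ_i(y) a_{xy,i}`, or the first arrow `a_{y,j}` of `B` is multiplied from the left by the start vertex
`x` of `A`, which gives `a_{xy,j}`. -/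
noncomputable def mulPath : G → List J → G → List J → E.CoPath
  | x, [], y, w => E.path (x * y) w
  | x, i :: v, y, [] => (E.χ i y : k) • E.prep i (mulPath (E.g i * x) v y [])
  | x, i :: v, y, j :: w =>
      (E.χ i y : k) • E.prep i (mulPath (E.g i * x) v y (j :: w)) +
        E.prep j (mulPath x (i :: v) (E.g j * y) w)
termination_by _ v _ w => v.length + w.length

/-- The bilinear extension of `mulPath`. -/
noncomputable def mulHom : E.CoPath →ₗ[k] E.CoPath →ₗ[k] E.CoPath :=
  E.lin fun x v => E.lin fun y w => E.mulPath x v y w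

noncomputable instance : NonUnitalNonAssocRing E.CoPath where
  mul a b := E.mulHom a b
  left_distrib a b c := map_add (E.mulHom a) b c
  right_distrib a b c := LinearMap.map_add₂ E.mulHom a b c
  zero_mul a := LinearMap.map_zero₂ E.mulHom a
  mul_zero a := map_zero (E.mulHom a)

instance : IsScalarTower k E.CoPath E.CoPath :=
  ⟨fun c a b => LinearMap.map_smul₂ E.mulHom c a b⟩

instance : SMulCommClass k E.CoPath E.CoPath :=
  ⟨fun c a b => ((E.mulHom a).map_smul c b).symm⟩

noncomputable instance : One E.CoPath := ⟨E.path 1 []⟩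

variable {E}

lemma comm_g (i : J) (x : G) : x * E.g i = E.g i * x :=
  (Subgroup.mem_center_iff.mp (E.g_mem_center i)) x

lemma comm_g' (i : J) (x : G) : x * (E.g i)⁻¹ = (E.g i)⁻¹ * x :=
  (Subgroup.mem_center_iff.mp (inv_mem (E.g_mem_center i))) x

@[simp] lemma prep_path (i : J) (x : G) (v : List J) :
    E.prep i (E.path x v) = E.path ((E.g i)⁻¹ * x) (i :: v) := by simp [prep]

@[simp] lemma tw_path (i : J) (x : G) (v : List J) :
    E.tw i (E.path x v) = (E.χ i x : k) • E.path x v := by simp [tw]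

lemma path_cons (i : J) (x : G) (v : List J) :
    E.path x (i :: v) = E.prep i (E.path (E.g i * x) v) := by simp

lemma mul_def (a b : E.CoPath) : a * b = E.mulHom a b := rfl

lemma path_mul_path (x y : G) (v w : List J) :
    E.path x v * E.path y w = E.mulPath x v y w := by simp [mul_def, mulHom]

lemma hom_ext₂ {M : Type*} [AddCommGroup M] [Module k M] {f h : E.CoPath →ₗ[k] E.CoPath →ₗ[k] M}
    (H : ∀ x v y w, f (E.path x v) (E.path y w) = h (E.path x v) (E.path y w)) (a b : E.CoPath) :
    f a b = h a b := by
  have : f = h := hom_ext fun x v => hom_ext fun y w => H x v y w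
  rw [this]

lemma vertex_mul_prep (x : G) (j : J) (b : E.CoPath) :
    E.path x [] * E.prep j b = E.prep j (E.path x [] * b) := by
  have : (E.mulHom (E.path x [])).comp (E.prep j) = (E.prep j).comp (E.mulHom (E.path x [])) := by
    refine hom_ext fun y w => ?_
    simp [mulHom, mulPath, ← mul_assoc, comm_g']
  exact LinearMap.congr_fun this b

lemma prep_mul_vertex (i : J) (a : E.CoPath) (y : G) :
    E.prep i a * E.path y [] = E.prep i (a * E.tw i (E.path y [])) := by
  have : (E.mulHom.flip (E.path y [])).comp (E.prep i) =
      (E.prep i).comp (E.mulHom.flip (E.tw i (E.path y []))) := by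
    refine hom_ext fun y w => ?_
    simp [mulHom, mulPath]
  exact LinearMap.congr_fun this a

lemma prep_mul_prep (i j : J) (a b : E.CoPath) :
    E.prep i a * E.prep j b =
      E.prep i (a * E.tw i (E.prep j b)) + E.prep j (E.prep i a * b) := by
  have := hom_ext₂ (E := E) (f := E.mulHom.compl₁₂ (E.prep i) (E.prep j))
    (h := (E.mulHom.compl₂ (E.tw i ∘ₗ E.prep j)).compr₂ (E.prep i) +
      (E.mulHom.comp (E.prep i)).compr₂ (E.prep j)) (fun x v y w => by
        simp [mulHom, mulPath]) a b
  simpa [mul_def] using this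

lemma prep_tw (i j : J) (a : E.CoPath) :
    E.tw i (E.prep j a) = (((E.χ i (E.g j))⁻¹ : kˣ) : k) • E.prep j (E.tw i a) := by
  have : (E.tw i) ∘ₗ (E.prep j) =
      (((E.χ i (E.g j))⁻¹ : kˣ) : k) • (E.prep j ∘ₗ E.tw i) := by
    refine hom_ext fun y w => ?_
    simp [smul_smul]
  exact LinearMap.congr_fun this a

lemma tw_tw (i j : J) (a : E.CoPath) : E.tw i (E.tw j a) = E.tw j (E.tw i a) := by
  have : E.tw i ∘ₗ E.tw j = E.tw j ∘ₗ E.tw i := by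
    refine hom_ext fun y w => ?_
    simp [smul_smul, mul_comm]
  exact LinearMap.congr_fun this a

lemma tw_mul (i : J) (a b : E.CoPath) : E.tw i (a * b) = E.tw i a * E.tw i b := by
  suffices H : ∀ (n : ℕ) (x : G) (v : List J) (y : G) (w : List J), v.length + w.length ≤ n →
      E.tw i (E.path x v * E.path y w) = E.tw i (E.path x v) * E.tw i (E.path y w) from
    hom_ext₂ (E := E) (f := E.mulHom.compr₂ (E.tw i))
      (h := E.mulHom.compl₁₂ (E.tw i) (E.tw i)) (fun x v y w => H _ x v y w le_rfl) a b
  intro n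
  induction n with
  | zero =>
    intro x v y w h
    obtain rfl : v = [] := List.length_eq_zero_iff.mp (by omega)
    simp only [tw_path, smul_mul_smul_comm, path_mul_path, mulPath, map_mul, Units.val_mul]
  | succ n ih =>
    intro x v y w h
    match v, w, h with
    | [], w, h => simp only [tw_path, smul_mul_smul_comm, path_mul_path, mulPath, map_mul, Units.val_mul]
    | i' :: v, [], h =>
      have h1 := ih (E.g i' * x) v y [] (by simp at h ⊢; omega)
      rw [path_cons, prep_mul_vertex, prep_tw, prep_tw, tw_path i' y, tw_path i y, mul_smul_comm,
        map_smul, h1, tw_path i y, smul_mul_assoc, mul_smul_comm, mul_smul_comm, prep_mul_vertex, tw_path i' y]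
      simp only [map_smul, mul_smul_comm]
      rw [smul_comm (E.χ i y : k)]
    | i' :: v, j :: w, h =>
      have h1 := ih (E.g i' * x) v y (j :: w) (by simp at h ⊢; omega)
      have h2 := ih x (i' :: v) (E.g j * y) w (by simp at h ⊢; omega)
      have h3 : E.tw i (E.path (E.g i' * x) v * E.tw i' (E.path y (j :: w))) =
          E.tw i (E.path (E.g i' * x) v) * E.tw i (E.tw i' (E.path y (j :: w))) := by
        rw [tw_path i' y, mul_smul_comm, map_smul, h1, map_smul, mul_smul_comm]
      rw [path_cons i', path_cons j] at *
      rw [prep_mul_prep, map_add, prep_tw i i', prep_tw i j (_ * _), h3, h2, prep_tw i i',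
        prep_tw i j (E.path _ w), smul_mul_smul_comm, prep_mul_prep, smul_add, tw_tw i i',
        prep_tw i j (E.path _ w)]
      simp only [map_smul, smul_smul, mul_smul_comm, smul_mul_assoc]
      congr 2
      rw [mul_comm]

protected lemma mul_assoc (a b c : E.CoPath) : a * b * c = a * (b * c) := by
  suffices H : ∀ (n : ℕ) (x : G) (u : List J) (y : G) (v : List J) (z : G) (w : List J),
      u.length + v.length + w.length ≤ n →
      E.path x u * E.path y v * E.path z w = E.path x u * (E.path y v * E.path z w) by
    have h1 : ∀ x u y v, E.mulHom (E.path x u * E.path y v) =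
        (E.mulHom (E.path x u)).comp (E.mulHom (E.path y v)) := fun x u y v =>
      hom_ext fun z w => H _ x u y v z w le_rfl
    have h2 : ∀ x u, E.mulHom.compr₂ (E.mulHom.flip c) (E.path x u) b =
        E.mulHom.compl₂ (E.mulHom.flip c) (E.path x u) b := fun x u =>
      LinearMap.congr_fun (hom_ext fun y v => LinearMap.congr_fun (h1 x u y v) c) b
    exact LinearMap.congr_fun (hom_ext (f := (E.mulHom.compr₂ (E.mulHom.flip c)).flip b)
      (h := (E.mulHom.compl₂ (E.mulHom.flip c)).flip b) h2) a
  intro n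
  induction n with
  | zero =>
    intro x u y v z w h
    obtain rfl : u = [] := List.length_eq_zero_iff.mp (by omega)
    obtain rfl : v = [] := List.length_eq_zero_iff.mp (by omega)
    simp [path_mul_path, mulPath, mul_assoc]
  | succ n ih =>
    intro x u y v z w h
    match u, v, w, h with
    | [], [], w, h => simp [path_mul_path, mulPath, mul_assoc]
    | [], j :: v, [], h =>
      have h1 := ih x [] (E.g j * y) v z [] (by simp at h ⊢; omega)
      rw [path_cons j, vertex_mul_prep, prep_mul_vertex, prep_mul_vertex, vertex_mul_prep,
        tw_path, mul_smul_comm, h1]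
      simp only [mul_smul_comm]
    | [], j :: v, l :: w, h =>
      have h1 := ih x [] (E.g j * y) v z (l :: w) (by simp at h ⊢; omega)
      have h2 := ih x [] y (j :: v) (E.g l * z) w (by simp at h ⊢; omega)
      have h3 : E.path x [] * E.path (E.g j * y) v * E.tw j (E.path z (l :: w)) =
          E.path x [] * (E.path (E.g j * y) v * E.tw j (E.path z (l :: w))) := by
        rw [tw_path, mul_smul_comm, h1, mul_smul_comm, mul_smul_comm]
      rw [path_cons j, path_cons l] at *
      rw [vertex_mul_prep, prep_mul_prep, prep_mul_prep, mul_add, vertex_mul_prep, vertex_mul_prep,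
        h3, ← h2, vertex_mul_prep]
    | i :: u, [], [], h =>
      have h1 := ih (E.g i * x) u y [] z [] (by simp at h ⊢; omega)
      rw [path_cons i, prep_mul_vertex, prep_mul_vertex, path_mul_path y, mulPath,
        prep_mul_vertex]
      rw [path_mul_path y, mulPath] at h1
      simp only [tw_path, mul_smul_comm, smul_mul_assoc, h1, smul_smul, map_mul, Units.val_mul]
      rw [mul_comm]
    | i :: u, [], l :: w, h =>
      have h1 := ih (E.g i * x) u y [] z (l :: w) (by simp at h ⊢; omega)
      have h2 := ih x (i :: u) y [] (E.g l * z) w (by simp at h ⊢; omega)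
      have h3 : E.path (E.g i * x) u * E.tw i (E.path y []) * E.tw i (E.path z (l :: w)) =
          E.path (E.g i * x) u * (E.tw i (E.path y [] * E.path z (l :: w))) := by
        rw [tw_mul]
        simp only [tw_path, mul_smul_comm, smul_mul_assoc, h1]
      rw [path_cons i, path_cons l] at *
      rw [prep_mul_vertex, prep_mul_prep, vertex_mul_prep, prep_mul_prep, h3, vertex_mul_prep,
        ← h2, prep_mul_vertex]
    | i :: u, j :: v, [], h =>
      have h1 := ih (E.g i * x) u y (j :: v) z [] (by simp at h ⊢; omega)
      have h2 := ih x (i :: u) (E.g j * y) v z [] (by simp at h ⊢; omega)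
      have h3 : E.path (E.g i * x) u * E.tw i (E.path y (j :: v)) * E.tw i (E.path z []) =
          E.path (E.g i * x) u * (E.tw i (E.path y (j :: v) * E.path z [])) := by
        rw [tw_mul]
        simp only [tw_path, mul_smul_comm, smul_mul_assoc, h1]
      have h4 : E.path x (i :: u) * E.path (E.g j * y) v * E.tw j (E.path z []) =
          E.path x (i :: u) * (E.path (E.g j * y) v * E.tw j (E.path z [])) := by
        simp only [tw_path, mul_smul_comm, h2]
      rw [path_cons i, path_cons j] at *
      rw [prep_mul_prep, add_mul, prep_mul_vertex, prep_mul_vertex, prep_mul_vertex, prep_mul_prep,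
        h3, h4, prep_mul_vertex]
    | i :: u, j :: v, l :: w, h =>
      have h1 := ih (E.g i * x) u y (j :: v) z (l :: w) (by simp at h ⊢; omega)
      have h2 := ih x (i :: u) (E.g j * y) v z (l :: w) (by simp at h ⊢; omega)
      have h3 := ih x (i :: u) y (j :: v) (E.g l * z) w (by simp at h ⊢; omega)
      have h4 : E.path (E.g i * x) u * E.tw i (E.path y (j :: v)) * E.tw i (E.path z (l :: w)) =
          E.path (E.g i * x) u * (E.tw i (E.path y (j :: v) * E.path z (l :: w))) := by
        rw [tw_mul]
        simp only [tw_path, mul_smul_comm, smul_mul_assoc, h1]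
      have h5 : E.path x (i :: u) * E.path (E.g j * y) v * E.tw j (E.path z (l :: w)) =
          E.path x (i :: u) * (E.path (E.g j * y) v * E.tw j (E.path z (l :: w))) := by
        simp only [tw_path, mul_smul_comm, h2]
      rw [path_cons i, path_cons j, path_cons l] at *
      rw [prep_mul_prep i j, prep_mul_prep j l, add_mul, prep_mul_prep i l, prep_mul_prep j l,
        mul_add, prep_mul_prep i j, prep_mul_prep i l, h4, h5, ← h3, prep_mul_prep i j,
        prep_mul_prep j l]
      simp only [map_add, add_mul, mul_add]
      abel

protected lemma one_mul (a : E.CoPath) : 1 * a = a := by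
  have : E.mulHom (E.path 1 []) = LinearMap.id := hom_ext fun y w => by
    simp [mulHom, mulPath]
  exact LinearMap.congr_fun this a

protected lemma mul_one (a : E.CoPath) : a * 1 = a := by
  have : E.mulHom.flip (E.path 1 []) = LinearMap.id := hom_ext fun y w => by
    simp only [mulHom, LinearMap.flip_apply, lin_path, LinearMap.id_apply]
    induction w generalizing y with
    | nil => simp [mulPath]
    | cons i w ih => simp [mulPath, ih]
  exact LinearMap.congr_fun this a

noncomputable instance : Ring E.CoPath :=
  { (inferInstance : NonUnitalNonAssocRing E.CoPath) with
    mul_assoc := ESC.mul_assoc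
    one_mul := ESC.one_mul
    mul_one := ESC.mul_one }

noncomputable instance : Algebra k E.CoPath := Algebra.ofModule smul_mul_assoc mul_smul_comm

lemma one_def : (1 : E.CoPath) = E.path 1 [] := rfl

variable (E)

/-- The product of the `g_i`, over the labels of a path; a path from `x` ends at `wt v * x`. -/
def wt (v : List J) : G := (v.map E.g).prod

/-- The comultiplication of the path coalgebra: the sum over all ways to cut a path in two, with
the final part on the left and the initial part on the right. -/
noncomputable def comulHom : E.CoPath →ₗ[k] E.CoPath ⊗[k] E.CoPath :=
  E.lin fun x v => ∑ l ∈ Finset.range (v.length + 1),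
    E.path (E.wt (v.take l) * x) (v.drop l) ⊗ₜ[k] E.path x (v.take l)

/-- The counit of the path coalgebra: `1` on vertices and `0` on longer paths. -/
noncomputable def counitHom : E.CoPath →ₗ[k] k :=
  E.lin fun _ v => if v.length = 0 then 1 else 0

variable {E}

lemma comulHom_nil (x : G) : E.comulHom (E.path x []) = E.path x [] ⊗ₜ[k] E.path x [] := by
  simp [comulHom, wt]

lemma comulHom_cons (x : G) (i : J) (v : List J) : E.comulHom (E.path x (i :: v)) =
    E.path x (i :: v) ⊗ₜ[k] E.path x [] +
      (E.prep i).lTensor E.CoPath (E.comulHom (E.path (E.g i * x) v)) := by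
  simp only [comulHom, lin_path, List.length_cons, map_sum, LinearMap.lTensor_tmul, prep_path]
  rw [Finset.sum_range_succ', add_comm]
  have h : ∀ l, E.wt (i :: v.take l) * x = E.wt (v.take l) * (E.g i * x) := fun l => by
    rw [wt, wt, List.map_cons, List.prod_cons, ← comm_g, mul_assoc]
  simp only [List.take_succ_cons, List.drop_succ_cons, inv_mul_cancel_left, h]
  simp [wt]

@[simp] lemma counitHom_path (x : G) (v : List J) :
    E.counitHom (E.path x v) = if v.length = 0 then 1 else 0 := by
  simp [counitHom]

lemma lTensor_comulHom_congr {M : Type*} [AddCommGroup M] [Module k M] (x : G)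
    {f h : E.CoPath →ₗ[k] M} (H : ∀ p, f (E.path x p) = h (E.path x p)) (v : List J) :
    f.lTensor E.CoPath (E.comulHom (E.path x v)) = h.lTensor E.CoPath (E.comulHom (E.path x v)) := by
  simp [comulHom, H]

lemma coassoc_path (x : G) (v : List J) :
    TensorProduct.assoc k E.CoPath E.CoPath E.CoPath
      (E.comulHom.rTensor E.CoPath (E.comulHom (E.path x v))) =
    E.comulHom.lTensor E.CoPath (E.comulHom (E.path x v)) := by
  induction v generalizing x with
  | nil => simp [comulHom_nil]
  | cons i v ih =>
    have h1 : ∀ t : E.CoPath ⊗[k] E.CoPath, TensorProduct.assoc k E.CoPath E.CoPath E.CoPath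
        (E.comulHom.rTensor E.CoPath ((E.prep i).lTensor E.CoPath t)) =
        ((E.prep i).lTensor E.CoPath).lTensor E.CoPath
          (TensorProduct.assoc k E.CoPath E.CoPath E.CoPath (E.comulHom.rTensor E.CoPath t)) := by
      intro t
      induction t with
      | zero => simp
      | add a b ha hb => simp only [map_add, ha, hb]
      | tmul a b =>
        simp only [LinearMap.lTensor_tmul, LinearMap.rTensor_tmul]
        induction E.comulHom a with
        | zero => simp
        | add a b ha hb => simp only [map_add, TensorProduct.add_tmul, ha, hb]
        | tmul a b => simp
    have h2 : ∀ t : E.CoPath ⊗[k] E.CoPath, TensorProduct.assoc k E.CoPath E.CoPath E.CoPath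
        (t ⊗ₜ E.path x []) =
        ((TensorProduct.mk k E.CoPath E.CoPath).flip (E.path x [])).lTensor E.CoPath t := by
      intro t
      induction t with
      | zero => simp
      | add a b ha hb => simp only [map_add, TensorProduct.add_tmul, ha, hb]
      | tmul a b => simp
    have h3 : (E.comulHom ∘ₗ E.prep i).lTensor E.CoPath (E.comulHom (E.path (E.g i * x) v)) =
        (((TensorProduct.mk k E.CoPath E.CoPath).flip (E.path x [])) ∘ₗ E.prep i +
          ((E.prep i).lTensor E.CoPath) ∘ₗ E.comulHom).lTensor E.CoPath
          (E.comulHom (E.path (E.g i * x) v)) := by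
      refine lTensor_comulHom_congr _ (fun p => ?_) v
      simp [comulHom_cons]
    rw [comulHom_cons]
    simp only [map_add, LinearMap.rTensor_tmul, LinearMap.lTensor_tmul]
    have h4 : ∀ t, E.comulHom.lTensor E.CoPath ((E.prep i).lTensor E.CoPath t) =
        (E.comulHom ∘ₗ E.prep i).lTensor E.CoPath t := fun t => by simp [LinearMap.lTensor_comp]
    rw [h1, ih, h2, h4, h3, comulHom_cons, comulHom_nil]
    simp [LinearMap.lTensor_add, LinearMap.lTensor_comp, add_assoc]

noncomputable instance : Coalgebra k E.CoPath where
  comul := E.comulHom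
  counit := E.counitHom
  coassoc := hom_ext coassoc_path
  rTensor_counit_comp_comul := hom_ext fun x v => by
    simp only [LinearMap.comp_apply]
    induction v generalizing x with
    | nil => simp [comulHom_nil]
    | cons i v ih =>
      have := congrArg ((E.prep i).lTensor k) (ih (E.g i * x))
      rw [comulHom_cons, map_add, ← LinearMap.comp_apply (LinearMap.rTensor _ _),
        LinearMap.rTensor_comp_lTensor, ← LinearMap.lTensor_comp_rTensor, LinearMap.comp_apply, this]
      simp
  lTensor_counit_comp_comul := hom_ext fun x v => by
    simp only [LinearMap.comp_apply]
    cases v with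
    | nil => simp [comulHom_nil]
    | cons i v =>
      have : E.counitHom ∘ₗ E.prep i = 0 := hom_ext fun x v => by simp
      rw [comulHom_cons, map_add, ← LinearMap.comp_apply (LinearMap.lTensor _ _),
        ← LinearMap.lTensor_comp, this]
      simp

lemma comul_eq (a : E.CoPath) : comul (R := k) a = E.comulHom a := rfl
lemma counit_eq (a : E.CoPath) : counit (R := k) a = E.counitHom a := rfl

lemma prepT_mul_prepT (i j : J) (A B : E.CoPath ⊗[k] E.CoPath) :
    (E.prep i).lTensor E.CoPath A * (E.prep j).lTensor E.CoPath B =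
      (E.prep i).lTensor E.CoPath
        (A * (E.tw i).lTensor E.CoPath ((E.prep j).lTensor E.CoPath B)) +
      (E.prep j).lTensor E.CoPath ((E.prep i).lTensor E.CoPath A * B) := by
  induction A with
  | zero => simp
  | add a b ha hb => simp only [map_add, add_mul, ha, hb]; abel
  | tmul a b =>
    induction B with
    | zero => simp
    | add a b ha hb => simp only [map_add, mul_add, ha, hb]; abel
    | tmul c d => simp [prep_mul_prep, TensorProduct.tmul_add]

lemma prepT_mul_vertex (i : J) (A : E.CoPath ⊗[k] E.CoPath) (b : E.CoPath) (y : G) :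
    (E.prep i).lTensor E.CoPath A * (b ⊗ₜ E.path y []) =
      (E.prep i).lTensor E.CoPath (A * (E.tw i).lTensor E.CoPath (b ⊗ₜ E.path y [])) := by
  induction A with
  | zero => simp
  | add a b ha hb => simp only [map_add, add_mul, ha, hb]
  | tmul c d =>
    simp only [LinearMap.lTensor_tmul, Algebra.TensorProduct.tmul_mul_tmul, prep_mul_vertex]

lemma vertex_mul_prepT (i : J) (B : E.CoPath ⊗[k] E.CoPath) (a : E.CoPath) (x : G) :
    (a ⊗ₜ E.path x []) * (E.prep i).lTensor E.CoPath B =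
      (E.prep i).lTensor E.CoPath ((a ⊗ₜ E.path x []) * B) := by
  induction B with
  | zero => simp
  | add a b ha hb => simp only [map_add, mul_add, ha, hb]
  | tmul c d =>
    simp only [LinearMap.lTensor_tmul, Algebra.TensorProduct.tmul_mul_tmul, vertex_mul_prep]

lemma comulHom_tw (i : J) (a : E.CoPath) :
    E.comulHom (E.tw i a) = (E.tw i).lTensor E.CoPath (E.comulHom a) := by
  suffices E.comulHom ∘ₗ E.tw i = (E.tw i).lTensor E.CoPath ∘ₗ E.comulHom from
    LinearMap.congr_fun this a
  exact hom_ext fun x v => by simp [comulHom, Finset.smul_sum]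

variable (E) in
/-- The linear map `p ↦ p ⊗ s(p)` where `s(p)` is the start vertex. -/
noncomputable def startHom : E.CoPath →ₗ[k] E.CoPath ⊗[k] E.CoPath :=
  E.lin fun z v => E.path z v ⊗ₜ[k] E.path z []

@[simp] lemma startHom_path (z : G) (v : List J) :
    E.startHom (E.path z v) = E.path z v ⊗ₜ[k] E.path z [] := by simp [startHom]

lemma startHom_prep (i : J) (a : E.CoPath) : E.startHom (E.prep i a) =
    TensorProduct.map (E.prep i) (E.mulHom (E.path (E.g i)⁻¹ [])) (E.startHom a) := by
  have : E.startHom ∘ₗ E.prep i =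
      TensorProduct.map (E.prep i) (E.mulHom (E.path (E.g i)⁻¹ [])) ∘ₗ E.startHom :=
    hom_ext fun x v => by simp [mulHom, mulPath]
  exact LinearMap.congr_fun this a

lemma startHom_mulPath (x : G) (v : List J) (y : G) (w : List J) :
    E.startHom (E.mulPath x v y w) = E.mulPath x v y w ⊗ₜ[k] E.path (x * y) [] := by
  fun_induction mulPath E x v y w with
  | case1 => simp
  | case2 x i v y ih =>
    rw [map_smul, startHom_prep, ih]
    simp [mulHom, mulPath, TensorProduct.smul_tmul', mul_assoc]
  | case3 x i v y j w ih1 ih2 =>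
    have hc : (E.g j)⁻¹ * (x * (E.g j * y)) = x * y := by
      rw [← mul_assoc x, comm_g, mul_assoc, inv_mul_cancel_left]
    rw [map_add, map_smul, startHom_prep, ih1, startHom_prep, ih2]
    simp [mulHom, mulPath, TensorProduct.smul_tmul', mul_assoc, TensorProduct.add_tmul, hc]

lemma comulHom_prep (i : J) (a : E.CoPath) :
    E.comulHom (E.prep i a) =
      E.startHom (E.prep i a) + (E.prep i).lTensor E.CoPath (E.comulHom a) := by
  have : E.comulHom ∘ₗ E.prep i = E.startHom ∘ₗ E.prep i +
      (E.prep i).lTensor E.CoPath ∘ₗ E.comulHom := hom_ext fun x v => by simp [comulHom_cons]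
  exact LinearMap.congr_fun this a

lemma wt_comm (x : G) (v : List J) : x * E.wt v = E.wt v * x := by
  induction v with
  | nil => simp [wt]
  | cons i v ih =>
    rw [wt, List.map_cons, List.prod_cons, ← mul_assoc, comm_g, mul_assoc]
    rw [wt] at ih
    rw [ih, mul_assoc]

lemma comulHom_path_mul (x : G) (v : List J) (y : G) (w : List J) :
    E.comulHom (E.path x v * E.path y w) = E.comulHom (E.path x v) * E.comulHom (E.path y w) := by
  suffices H : ∀ (n : ℕ) (x : G) (v : List J) (y : G) (w : List J), v.length + w.length ≤ n →
      E.comulHom (E.path x v * E.path y w) = E.comulHom (E.path x v) * E.comulHom (E.path y w) from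
    H _ x v y w le_rfl
  have nil_mul : ∀ (x y : G) (w : List J),
      E.comulHom (E.path x [] * E.path y w) =
        E.comulHom (E.path x []) * E.comulHom (E.path y w) := by
    intro x y w
    rw [path_mul_path, mulPath, comulHom_nil]
    simp only [comulHom, lin_path, Finset.mul_sum, Algebra.TensorProduct.tmul_mul_tmul,
      path_mul_path, mulPath]
    refine Finset.sum_congr rfl fun l _ => ?_
    rw [← mul_assoc x, wt_comm, mul_assoc]
  intro n
  induction n with
  | zero =>
    intro x v y w h
    obtain rfl : v = [] := List.length_eq_zero_iff.mp (by omega)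
    exact nil_mul x y w
  | succ n ih =>
    intro x v y w h
    match v, w, h with
    | [], w, h => exact nil_mul x y w
    | i :: v, [], h =>
      have h1 := ih (E.g i * x) v y [] (by simp at h ⊢; omega)
      have h2 : E.startHom (E.path x (i :: v) * E.path y []) =
        (E.path x (i :: v) ⊗ₜ E.path x []) * (E.path y [] ⊗ₜ E.path y []) := by
        rw [path_mul_path, startHom_mulPath, Algebra.TensorProduct.tmul_mul_tmul, path_mul_path,
          path_mul_path x, mulPath.eq_1]
      rw [comulHom_cons, comulHom_nil, add_mul, prepT_mul_vertex, ← h2, path_cons, prep_mul_vertex,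
        comulHom_prep, tw_path, mul_smul_comm, map_smul E.comulHom, h1, comulHom_nil, map_smul (E.prep i),
        map_smul E.startHom, map_smul (LinearMap.lTensor _ _), LinearMap.lTensor_tmul, tw_path,
        TensorProduct.tmul_smul, mul_smul_comm, map_smul (LinearMap.lTensor _ _)]
    | i :: v, j :: w, h =>
      have h1 := ih (E.g i * x) v y (j :: w) (by simp at h ⊢; omega)
      have h2 := ih x (i :: v) (E.g j * y) w (by simp at h ⊢; omega)
      have h3 : E.startHom (E.path x (i :: v) * E.path y (j :: w)) =
        (E.path x (i :: v) ⊗ₜ E.path x []) * (E.path y (j :: w) ⊗ₜ E.path y []) := by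
        rw [path_mul_path, startHom_mulPath, Algebra.TensorProduct.tmul_mul_tmul, path_mul_path,
          path_mul_path x, mulPath.eq_1]
      have h4 : E.comulHom (E.path (E.g i * x) v * E.tw i (E.path y (j :: w))) =
          E.comulHom (E.path (E.g i * x) v) *
            (E.tw i).lTensor E.CoPath (E.comulHom (E.path y (j :: w))) := by
        rw [← comulHom_tw, tw_path, mul_smul_comm, map_smul, h1, map_smul, mul_smul_comm]
      have h5 : E.path x (i :: v) * E.path y (j :: w) =
          E.prep i (E.path (E.g i * x) v * E.tw i (E.path y (j :: w))) +
            E.prep j (E.path x (i :: v) * E.path (E.g j * y) w) := by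
        rw [path_cons i, path_cons j, prep_mul_prep]
      have h6 : E.comulHom (E.path x (i :: v) * E.path y (j :: w)) =
          E.startHom (E.path x (i :: v) * E.path y (j :: w)) +
          (E.prep i).lTensor E.CoPath (E.comulHom (E.path (E.g i * x) v) *
            (E.tw i).lTensor E.CoPath (E.comulHom (E.path y (j :: w)))) +
          (E.prep j).lTensor E.CoPath (E.comulHom (E.path x (i :: v)) *
            E.comulHom (E.path (E.g j * y) w)) := by
        rw [← h4, ← h2, h5, map_add, comulHom_prep, comulHom_prep, map_add]
        abel
      rw [h6, h3, comulHom_cons x, comulHom_cons y]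
      simp only [add_mul, mul_add, map_add, prepT_mul_vertex, prepT_mul_prepT, vertex_mul_prepT]
      abel

noncomputable instance : Bialgebra k E.CoPath :=
  Bialgebra.mk' k E.CoPath
    (by rw [counit_eq, one_def]; simp)
    (by
      intro a b
      have h0 : ∀ (x : G) (v : List J) (y : G) (w : List J),
          E.counitHom (E.mulPath x v y w) =
            E.counitHom (E.path x v) * E.counitHom (E.path y w) := by
        have hp : ∀ i a, E.counitHom (E.prep i a) = 0 := fun i a => by
          have : E.counitHom ∘ₗ E.prep i = 0 := hom_ext fun x v => by simp
          exact LinearMap.congr_fun this a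
        intro x v y w
        cases v <;> cases w <;> simp [mulPath, hp]
      exact hom_ext₂ (E := E) (f := E.mulHom.compr₂ E.counitHom)
        (h := (LinearMap.mul k k).compl₁₂ E.counitHom E.counitHom)
        (fun x v y w => by simp [mulHom, h0]) a b)
    (by rw [comul_eq, one_def, comulHom_nil]; rfl)
    (by
      intro a b
      exact hom_ext₂ (E := E) (f := E.mulHom.compr₂ E.comulHom)
        (h := (LinearMap.mul k (E.CoPath ⊗[k] E.CoPath)).compl₁₂ E.comulHom E.comulHom)
        (fun x v y w => comulHom_path_mul x v y w) a b)

variable (E) in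
/-- The antipode on paths, computed recursively from `∑ S(p₁) p₂ = ε(p)`. -/
noncomputable def antipodePath : G → List J → E.CoPath
  | x, [] => E.path x⁻¹ []
  | x, i :: v =>
      -(∑ l : Fin (v.length + 1), antipodePath (E.wt (i :: v.take l) * x) (v.drop l) *
        E.path x (i :: v.take l)) * E.path x⁻¹ []
termination_by _ v => v.length
decreasing_by simp

variable (E) in
/-- The right convolution inverse of the identity on paths; it agrees with the antipode. -/
noncomputable def rightInvPath : G → List J → E.CoPath
  | x, [] => E.path x⁻¹ []
  | x, i :: v =>
      - (E.path (E.wt (i :: v) * x)⁻¹ [] * ∑ l : Fin (v.length + 1),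
        E.path (E.wt ((i :: v).take l) * x) ((i :: v).drop l) *
          rightInvPath x ((i :: v).take l))
termination_by _ v => v.length
decreasing_by simp; omega

@[simp] lemma vertex_mul_inv (x : G) : E.path x [] * E.path x⁻¹ [] = 1 := by
  simp [path_mul_path, mulPath, one_def]

@[simp] lemma vertex_inv_mul (x : G) : E.path x⁻¹ [] * E.path x [] = 1 := by
  simp [path_mul_path, mulPath, one_def]

variable (E) in
/-- The antipode of the co-path Hopf algebra. -/
noncomputable def antipodeHom : E.CoPath →ₗ[k] E.CoPath := E.lin E.antipodePath

open WithConv LinearMap in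
lemma antipode_conv : toConv E.antipodeHom * toConv (LinearMap.id : E.CoPath →ₗ[k] E.CoPath) = 1 := by
  refine WithConv.ext (hom_ext fun x v => ?_)
  change LinearMap.mul' k E.CoPath (TensorProduct.map E.antipodeHom LinearMap.id
    (E.comulHom (E.path x v))) = algebraMap k E.CoPath (E.counitHom (E.path x v))
  cases v with
  | nil => simp [comulHom_nil, antipodeHom, antipodePath]
  | cons i v =>
    simp only [comulHom, lin_path, map_sum, TensorProduct.map_tmul, LinearMap.mul'_apply,
      LinearMap.id_apply, antipodeHom]
    rw [Finset.sum_range_succ']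
    simp only [List.take_zero, List.drop_zero, List.take_succ_cons, List.drop_succ_cons]
    rw [show E.wt [] * x = x by simp [wt], antipodePath, mul_assoc, vertex_inv_mul, mul_one,
      Finset.sum_range]
    simp

open WithConv LinearMap in
lemma rightInv_conv :
    toConv (LinearMap.id : E.CoPath →ₗ[k] E.CoPath) * toConv (E.lin E.rightInvPath) = 1 := by
  refine WithConv.ext (hom_ext fun x v => ?_)
  change LinearMap.mul' k E.CoPath (TensorProduct.map LinearMap.id (E.lin E.rightInvPath)
    (E.comulHom (E.path x v))) = algebraMap k E.CoPath (E.counitHom (E.path x v))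
  cases v with
  | nil => simp [comulHom_nil, rightInvPath]
  | cons i v =>
    simp only [comulHom, lin_path, map_sum, TensorProduct.map_tmul, LinearMap.mul'_apply,
      LinearMap.id_apply]
    rw [Finset.sum_range_succ, List.take_length, List.drop_length, rightInvPath, mul_neg,
      ← mul_assoc, vertex_mul_inv, one_mul, Finset.sum_range]
    simp

/-- The co-path Hopf algebra `kQᶜ` of the system. -/
noncomputable instance : HopfAlgebra k E.CoPath :=
  HopfAlgebra.ofConvInverse E.antipodeHom antipode_conv
    (by
      have h := left_inv_eq_right_inv (antipode_conv (E := E)) rightInv_conv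
      rw [h]
      exact rightInv_conv)

end CoPathSpace

section Taft
variable {k G J : Type*} [Field k] [Group G] (E : ESC k G J)

/-- The multiple Taft algebra `kG[kQ₁ᶜ]`: the subalgebra of the co-path Hopf algebra
generated by `kG`, i.e. by the vertices, and the space of arrows. -/
noncomputable def taft : Subalgebra k E.CoPath :=
  Algebra.adjoin k (Set.range (fun x : G => E.path x []) ∪
    Set.range (fun p : G × J => E.path p.1 [p.2]))

/-- The multiple Taft algebra, as a type. -/
abbrev Taft : Type _ := ↥E.taft

variable {E}

/-- A vertex as an element of the multiple Taft algebra. -/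
noncomputable def taftVertex (x : G) : E.Taft :=
  ⟨E.path x [], Algebra.subset_adjoin (Or.inl ⟨x, rfl⟩)⟩

/-- An arrow as an element of the multiple Taft algebra. -/
noncomputable def taftArrow (x : G) (i : J) : E.Taft :=
  ⟨E.path x [i], Algebra.subset_adjoin (Or.inr ⟨(x, i), rfl⟩)⟩

lemma taft_algHom_ext {B : Type*} [Semiring B] [Algebra k B] {f h : E.Taft →ₐ[k] B}
    (h1 : ∀ x, f (taftVertex x) = h (taftVertex x))
    (h2 : ∀ x i, f (taftArrow x i) = h (taftArrow x i)) : f = h := by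
  refine AlgHom.adjoin_ext ?_
  rintro _ (⟨x, rfl⟩ | ⟨⟨x, i⟩, rfl⟩)
  · exact h1 x
  · exact h2 x i

variable (E) in
/-- The inclusion of the tensor squares. -/
noncomputable def taftIncl : E.Taft ⊗[k] E.Taft →ₐ[k] E.CoPath ⊗[k] E.CoPath :=
  Algebra.TensorProduct.map E.taft.val E.taft.val

lemma taftIncl_injective : Function.Injective E.taftIncl :=
  TensorProduct.map_injective_of_flat_flat E.taft.val.toLinearMap E.taft.val.toLinearMap
    Subtype.val_injective Subtype.val_injective

lemma comul_vertex (x : G) :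
    Bialgebra.comulAlgHom k E.CoPath (E.path x []) = E.path x [] ⊗ₜ E.path x [] :=
  comulHom_nil x

lemma comul_arrow (x : G) (i : J) : Bialgebra.comulAlgHom k E.CoPath (E.path x [i]) =
      E.path x [i] ⊗ₜ E.path x [] + E.path (E.g i * x) [] ⊗ₜ E.path x [i] :=
  (comulHom_cons x i []).trans (by simp [comulHom_nil])

lemma comul_mem_range (a : E.Taft) :
    (Bialgebra.comulAlgHom k E.CoPath).comp E.taft.val a ∈ E.taftIncl.range := by
  obtain ⟨a, ha⟩ := a
  have : E.taft ≤ E.taftIncl.range.comap (Bialgebra.comulAlgHom k E.CoPath) := by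
    refine Algebra.adjoin_le ?_
    rintro _ (⟨x, rfl⟩ | ⟨⟨x, i⟩, rfl⟩)
    · exact ⟨taftVertex x ⊗ₜ taftVertex x, (comul_vertex x).symm⟩
    · refine ⟨taftArrow x i ⊗ₜ taftVertex x + taftVertex (E.g i * x) ⊗ₜ taftArrow x i, ?_⟩
      refine Eq.trans ?_ (comul_arrow x i).symm
      exact map_add _ _ _
  exact this ha

variable (E) in
/-- The restriction of the comultiplication. -/
noncomputable def taftComul : E.Taft →ₐ[k] E.Taft ⊗[k] E.Taft :=
  (AlgEquiv.ofInjective E.taftIncl taftIncl_injective).symm.toAlgHom.comp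
    (((Bialgebra.comulAlgHom k E.CoPath).comp E.taft.val).codRestrict E.taftIncl.range
      comul_mem_range)

lemma taftIncl_taftComul (a : E.Taft) :
    E.taftIncl (E.taftComul a) = Bialgebra.comulAlgHom k E.CoPath a := by
  have := AlgEquiv.apply_symm_apply (AlgEquiv.ofInjective E.taftIncl taftIncl_injective)
    ((((Bialgebra.comulAlgHom k E.CoPath).comp E.taft.val).codRestrict E.taftIncl.range
      comul_mem_range) a)
  exact congrArg Subtype.val this

@[simp] lemma taftComul_vertex (x : G) :
    E.taftComul (taftVertex x) = taftVertex x ⊗ₜ taftVertex x :=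
  taftIncl_injective ((taftIncl_taftComul _).trans (comul_vertex x))

@[simp] lemma taftComul_arrow (x : G) (i : J) : E.taftComul (taftArrow x i) =
    taftArrow x i ⊗ₜ taftVertex x + taftVertex (E.g i * x) ⊗ₜ taftArrow x i :=
  taftIncl_injective ((taftIncl_taftComul _).trans ((comul_arrow x i).trans
    (map_add E.taftIncl (taftArrow x i ⊗ₜ taftVertex x)
      (taftVertex (E.g i * x) ⊗ₜ taftArrow x i)).symm))

variable (E) in
/-- The restriction of the counit. -/
noncomputable def taftCounit : E.Taft →ₐ[k] k :=
  (Bialgebra.counitAlgHom k E.CoPath).comp E.taft.val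

@[simp] lemma taftCounit_vertex (x : G) : E.taftCounit (taftVertex x) = 1 :=
  (counitHom_path (E := E) x []).trans (by simp)

@[simp] lemma taftCounit_arrow (x : G) (i : J) : E.taftCounit (taftArrow x i) = 0 :=
  (counitHom_path (E := E) x [i]).trans (by simp)

noncomputable instance : Bialgebra k E.Taft :=
  Bialgebra.ofAlgHom E.taftComul E.taftCounit
    (taft_algHom_ext (fun x => by simp) (fun x i => by
      simp [TensorProduct.add_tmul, TensorProduct.tmul_add, add_assoc]))
    (taft_algHom_ext (fun x => by simp) (fun x i => by simp))
    (taft_algHom_ext (fun x => by simp) (fun x i => by simp))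

lemma antipode_vertex (x : G) :
    HopfAlgebra.antipode k (E.path x []) = E.path x⁻¹ [] := by
  change E.antipodeHom _ = _
  simp [antipodeHom, antipodePath]

lemma antipode_arrow (x : G) (i : J) : HopfAlgebra.antipode k (E.path x [i]) =
    -(E.path (E.g i * x)⁻¹ [] * E.path x [i]) * E.path x⁻¹ [] := by
  change E.antipodeHom _ = _
  simp [antipodeHom, antipodePath, wt]

lemma antipode_mem (a : E.Taft) : HopfAlgebra.antipode k (a : E.CoPath) ∈ E.taft := by
  obtain ⟨a, ha⟩ := a
  change HopfAlgebra.antipode k a ∈ E.taft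
  induction ha using Algebra.adjoin_induction with
  | mem a h =>
    obtain ⟨x, rfl⟩ | ⟨⟨x, i⟩, rfl⟩ := h
    · simp only [antipode_vertex]; exact (taftVertex _).2
    · simp only [antipode_arrow]
      exact mul_mem (neg_mem (mul_mem (taftVertex _).2 (taftArrow _ _).2)) (taftVertex _).2
  | algebraMap r =>
    rw [Algebra.algebraMap_eq_smul_one, map_smul, HopfAlgebra.antipode_one]
    exact E.taft.smul_mem (one_mem _) r
  | add a b _ _ ha hb => rw [map_add]; exact add_mem ha hb
  | mul a b _ _ ha hb => rw [HopfAlgebra.antipode_mul_antidistrib]; exact mul_mem hb ha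

variable (E) in
/-- The restriction of the antipode. -/
noncomputable def taftAntipode : E.Taft →ₗ[k] E.Taft :=
  ((HopfAlgebra.antipode k (A := E.CoPath)).comp E.taft.val.toLinearMap).codRestrict
    (Subalgebra.toSubmodule E.taft) antipode_mem

/-- The multiple Taft algebra is a Hopf subalgebra of the co-path Hopf algebra. -/
noncomputable instance : HopfAlgebra k E.Taft where
  antipode := E.taftAntipode
  mul_antipode_rTensor_comul := by
    have h : ∀ t : E.Taft ⊗[k] E.Taft,
        ((LinearMap.mul' k E.Taft (E.taftAntipode.rTensor E.Taft t) : E.Taft) : E.CoPath) =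
        LinearMap.mul' k E.CoPath ((HopfAlgebra.antipode k).rTensor E.CoPath (E.taftIncl t)) := by
      intro t
      induction t with
      | zero => simp
      | add a b ha hb => simp only [map_add, Subalgebra.coe_add, ha, hb]
      | tmul a b => rfl
    refine LinearMap.ext fun a => Subtype.ext ((h _).trans ?_)
    refine (congrArg _ (congrArg _ (taftIncl_taftComul a))).trans ?_
    exact HopfAlgebra.mul_antipode_rTensor_comul_apply (R := k) (a : E.CoPath)
  mul_antipode_lTensor_comul := by
    have h : ∀ t : E.Taft ⊗[k] E.Taft,
        ((LinearMap.mul' k E.Taft (E.taftAntipode.lTensor E.Taft t) : E.Taft) : E.CoPath) =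
        LinearMap.mul' k E.CoPath ((HopfAlgebra.antipode k).lTensor E.CoPath (E.taftIncl t)) := by
      intro t
      induction t with
      | zero => simp
      | add a b ha hb => simp only [map_add, Subalgebra.coe_add, ha, hb]
      | tmul a b => rfl
    refine LinearMap.ext fun a => Subtype.ext ((h _).trans ?_)
    refine (congrArg _ (congrArg _ (taftIncl_taftComul a))).trans ?_
    exact HopfAlgebra.mul_antipode_lTensor_comul_apply (R := k) (a : E.CoPath)

variable (E) in
/-- The grading of the multiple Taft algebra by the length of paths. -/
noncomputable def taftGrading (n : ℕ) : Submodule k E.Taft :=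
  (Submodule.span k {a : E.CoPath | ∃ x v, v.length = n ∧ a = E.path x v}).comap
    E.taft.val.toLinearMap

end Taft

section QBinomial
variable {k A : Type*} [Field k] [Ring A] [Algebra k A]

/-- Gaussian binomial coefficients, by the `q`-Pascal recursion. -/
def gauss (q : k) : ℕ → ℕ → k
  | _, 0 => 1
  | 0, _ + 1 => 0
  | n + 1, j + 1 => gauss q n j + q ^ (j + 1) * gauss q n (j + 1)

@[simp] lemma gauss_zero (q : k) (n : ℕ) : gauss q n 0 = 1 := by cases n <;> rfl

lemma gauss_succ (q : k) (n j : ℕ) :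
    gauss q (n + 1) (j + 1) = gauss q n j + q ^ (j + 1) * gauss q n (j + 1) := rfl

lemma gauss_eq_zero (q : k) {n j : ℕ} (h : n < j) : gauss q n j = 0 := by
  induction n generalizing j with
  | zero => obtain ⟨j, rfl⟩ := Nat.exists_eq_succ_of_ne_zero (by omega : j ≠ 0); rfl
  | succ n ih =>
    obtain ⟨j, rfl⟩ := Nat.exists_eq_succ_of_ne_zero (by omega : j ≠ 0)
    rw [Nat.succ_eq_add_one, gauss_succ, ih (by omega), ih (by omega)]; simp

lemma gauss_self (q : k) (n : ℕ) : gauss q n n = 1 := by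
  induction n with
  | zero => simp
  | succ n ih => rw [gauss_succ, ih, gauss_eq_zero q (Nat.lt_succ_self n)]; simp

lemma gauss_mul (q : k) (m j : ℕ) :
    (q ^ (j + 1) - 1) * gauss q (j + m) (j + 1) = (q ^ m - 1) * gauss q (j + m) j := by
  obtain ⟨n, hn⟩ : ∃ n, n = j + m := ⟨_, rfl⟩
  induction n generalizing j m with
  | zero =>
    obtain rfl : j = 0 := by omega
    obtain rfl : m = 0 := by omega
    simp [gauss]
  | succ n ih =>
    rw [← hn]
    rcases m with _ | m
    · rw [gauss_eq_zero q (by omega : n + 1 < j + 1)]; simp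
    · have h1 := ih m j (by omega)
      rw [show j + m = n by omega] at h1
      rcases j with _ | j
      · obtain rfl : m = n := by omega
        rw [gauss_succ]
        simp only [gauss_zero] at *
        linear_combination q ^ 1 * h1
      · have h2 := ih (m + 1) j (by omega)
        rw [show j + (m + 1) = n by omega] at h2
        rw [gauss_succ, gauss_succ]
        linear_combination q ^ (j + 1 + 1) * h1 + h2

lemma gauss_orderOf (q : k) {j : ℕ} (h0 : j ≠ 0) (hj : j < orderOf q) :
    gauss q (orderOf q) j = 0 := by
  obtain ⟨j, rfl⟩ := Nat.exists_eq_succ_of_ne_zero h0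
  obtain ⟨n, hn⟩ := Nat.exists_eq_succ_of_ne_zero (by omega : orderOf q ≠ 0)
  have hq : q ^ (n + 1) = 1 := by rw [← Nat.succ_eq_add_one, ← hn]; exact pow_orderOf_eq_one q
  have h1 := gauss_mul q (n - j) j
  rw [show j + (n - j) = n by omega] at h1
  have hjn : q ^ (n + 1) = q ^ (j + 1) * q ^ (n - j) := by rw [← pow_add]; congr 1; omega
  have h2 : (q ^ (j + 1) - 1) * gauss q (n + 1) (j + 1) = 0 := by
    rw [gauss_succ]
    linear_combination q ^ (j + 1) * h1 + (gauss q n j) * (hq - hjn)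
  rcases mul_eq_zero.mp h2 with h | h
  · exact absurd (sub_eq_zero.mp h) (pow_ne_one_of_lt_orderOf (Nat.succ_ne_zero j) hj)
  · rw [hn]; exact h

lemma add_pow_gauss (q : k) (a b : A) (h : a * b = q • (b * a)) (n : ℕ) :
    (a + b) ^ n = ∑ j ∈ Finset.range (n + 1), gauss q n j • (b ^ j * a ^ (n - j)) := by
  have hp : ∀ j, a * b ^ j = q ^ j • (b ^ j * a) := by
    intro j
    induction j with
    | zero => simp
    | succ j ih =>
      rw [pow_succ, ← mul_assoc, ih, smul_mul_assoc, mul_assoc, h, mul_smul_comm, smul_smul,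
        ← mul_assoc, pow_succ]
  induction n with
  | zero => simp
  | succ n ih =>
    have h1 : ∀ j ∈ Finset.range (n + 1), a * gauss q n j • (b ^ j * a ^ (n - j)) =
        (q ^ j * gauss q n j) • (b ^ j * a ^ (n + 1 - j)) := by
      intro j hj
      have hj' := Finset.mem_range.mp hj
      rw [mul_smul_comm, ← mul_assoc, hp, smul_mul_assoc, smul_smul, mul_assoc, ← pow_succ',
        show n - j + 1 = n + 1 - j by omega, mul_comm]
    rw [pow_succ', ih, add_mul, Finset.mul_sum, Finset.mul_sum, Finset.sum_congr rfl h1,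
      Finset.sum_range_succ' _ (n + 1)]
    have h2 : ∑ j ∈ Finset.range (n + 1), (q ^ j * gauss q n j) • (b ^ j * a ^ (n + 1 - j)) =
        ∑ j ∈ Finset.range (n + 1),
          (q ^ (j + 1) * gauss q n (j + 1)) • (b ^ (j + 1) * a ^ (n - j)) + a ^ (n + 1) := by
      have h3 : ∑ j ∈ Finset.range (n + 1), (q ^ j * gauss q n j) • (b ^ j * a ^ (n + 1 - j)) =
          ∑ j ∈ Finset.range (n + 1 + 1),
            (q ^ j * gauss q n j) • (b ^ j * a ^ (n + 1 - j)) := by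
        rw [Finset.sum_range_succ _ (n + 1), gauss_eq_zero q (Nat.lt_succ_self n)]; simp
      rw [h3, Finset.sum_range_succ']
      simp
    rw [h2]
    simp only [gauss_succ, add_smul, Finset.sum_add_distrib, mul_smul_comm, ← mul_assoc,
      ← pow_succ', Nat.add_sub_add_right, gauss_zero, one_smul, pow_zero, one_mul, Nat.sub_zero]
    abel

lemma add_pow_orderOf (q : k) (hq : 1 < orderOf q) (a b : A) (h : a * b = q • (b * a)) :
    (a + b) ^ orderOf q = a ^ orderOf q + b ^ orderOf q := by
  rw [add_pow_gauss q a b h, Finset.sum_range_succ, gauss_self, Finset.sum_eq_single 0]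
  · simp
  · intro j hj h0
    rw [gauss_orderOf q h0 (Finset.mem_range.mp hj), zero_smul]
  · intro h; exact absurd (Finset.mem_range.mpr (by omega)) h

end QBinomial

section Graded
variable (k : Type*) {B : Type*} [Field k] [Ring B] [HopfAlgebra k B]

/-- The subspaces `𝒜 n` form a grading of the Hopf algebra `B`: it is their direct sum, and all
structure maps respect degrees. -/
structure IsGradedHopf (𝒜 : ℕ → Submodule k B) : Prop where
  isInternal : DirectSum.IsInternal 𝒜
  one_mem : (1 : B) ∈ 𝒜 0
  mul_mem : ∀ m n, ∀ a ∈ 𝒜 m, ∀ b ∈ 𝒜 n, a * b ∈ 𝒜 (m + n)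
  comul_mem : ∀ n, ∀ a ∈ 𝒜 n, comul (R := k) a ∈ ⨆ p ∈ Finset.HasAntidiagonal.antidiagonal n,
    LinearMap.range (TensorProduct.map (𝒜 p.1).subtype (𝒜 p.2).subtype)
  counit_eq_zero : ∀ n, n ≠ 0 → ∀ a ∈ 𝒜 n, counit (R := k) a = 0
  antipode_mem : ∀ n, ∀ a ∈ 𝒜 n, HopfAlgebra.antipode k a ∈ 𝒜 n

end Graded

section System
variable {k G J : Type*} [Field k] [Group G] (E : ESC k G J)

/-- A Hopf algebra `A` as in the definition of `H(G, g_i, χ_i)`, i.e. with the following data: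
* an identification `ι` of `G` with a subgroup of the group of group-like elements of `A`;
* a linearly independent family `X i`, `i : J`, which together with `G` generates `A`;
* `X j` is `(1, g_j)`-primitive, `X j h = χ_j(h) h X j` for `h` in `G`, and
  `X j X i = χ_j(g_i) X i X j` for `i ≠ j`;
* `kG` and the span of the elements `h X i` meet in zero. -/
structure System (A : Type*) [Ring A] [HopfAlgebra k A] where
  ι : G →* A
  X : J → A
  ι_injective : Function.Injective ι
  isGroupLikeElem_ι : ∀ h, IsGroupLikeElem k (ι h)
  linearIndependent_X : LinearIndependent k X
  adjoin_eq_top : Algebra.adjoin k (Set.range ι ∪ Set.range X) = ⊤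
  comul_X : ∀ j, comul (R := k) (X j) = X j ⊗ₜ 1 + ι (E.g j) ⊗ₜ X j
  X_mul_ι : ∀ j h, X j * ι h = (E.χ j h : k) • (ι h * X j)
  X_mul_X : ∀ i j, i ≠ j → X j * X i = (E.χ j (E.g i) : k) • (X i * X j)
  disjoint : Disjoint (Submodule.span k (Set.range ι))
    (Submodule.span k (Set.range fun p : G × J => ι p.1 * X p.2))

/-- The relations between generators `h` in `G` and `X i`, `i : J`, of an algebra: those of the
group `G`, `X j h = χ_j(h) h X j`, and `X j X i = χ_j(g_i) X i X j` for `i ≠ j`. -/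
inductive Rel : FreeAlgebra k (G ⊕ J) → FreeAlgebra k (G ⊕ J) → Prop
  | one : Rel (FreeAlgebra.ι k (Sum.inl 1)) 1
  | mul (h h' : G) : Rel (FreeAlgebra.ι k (Sum.inl (h * h')))
      (FreeAlgebra.ι k (Sum.inl h) * FreeAlgebra.ι k (Sum.inl h'))
  | X_mul_group (j : J) (h : G) :
      Rel (FreeAlgebra.ι k (Sum.inr j) * FreeAlgebra.ι k (Sum.inl h))
        ((E.χ j h : k) • (FreeAlgebra.ι k (Sum.inl h) * FreeAlgebra.ι k (Sum.inr j)))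
  | X_mul_X (i j : J) (hij : i ≠ j) :
      Rel (FreeAlgebra.ι k (Sum.inr j) * FreeAlgebra.ι k (Sum.inr i))
        ((E.χ j (E.g i) : k) • (FreeAlgebra.ι k (Sum.inr i) * FreeAlgebra.ι k (Sum.inr j)))

namespace System
variable {E} {A : Type*} [Ring A] [HopfAlgebra k A] (D : E.System A)

/-- The subspace of elements of degree `n`: the span of the products `h X_{i_1} ⋯ X_{i_n}`, with `h`
in `G`. In degree `0` it is `kG`, in degree `1` it is the span of the `h X i`. -/
def deg (n : ℕ) : Submodule k A :=
  Submodule.span k {a | ∃ (h : G) (v : List J), v.length = n ∧ a = D.ι h * (v.map D.X).prod}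

/-- `A` is graded, with the elements of `G` in degree `0` and the `X i` in degree `1`. -/
def IsGraded : Prop := DirectSum.IsInternal D.deg

/-- `A` is the algebra with generators `G` and `X i` and defining relations `Rel`. -/
def IsPresented : Prop :=
  ∃ e : RingQuot E.Rel ≃ₐ[k] A,
    (∀ h, e (RingQuot.mkAlgHom k E.Rel (FreeAlgebra.ι k (Sum.inl h))) = D.ι h) ∧
    ∀ i, e (RingQuot.mkAlgHom k E.Rel (FreeAlgebra.ι k (Sum.inr i))) = D.X i

/-- The elements `X_i ^ N_i`, for all `i` with `N_i` finite. -/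
def powers : Set A := {a | ∃ (i : J) (n : ℕ), (n : ℕ∞) = E.N i ∧ a = D.X i ^ n}

/-- The two-sided ideal generated by the `X_i ^ N_i`, for all `i` with `N_i` finite. -/
abbrev ideal : Ideal A := (TwoSidedIdeal.span D.powers).asIdeal

variable {D}

lemma counit_X (j : J) : counit (R := k) (D.X j) = 0 := by
  have := Bialgebra.nontrivial k (A := A)
  have h := congrArg (fun t => TensorProduct.lid k A (counit.rTensor A t)) (D.comul_X j)
  simp only [Coalgebra.rTensor_counit_comul] at h
  simpa [(D.isGroupLikeElem_ι _).counit_eq_one, Algebra.algebraMap_eq_smul_one] using h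

lemma powers_spec {a : A} (ha : a ∈ D.powers) :
    ∃ (i : J) (n : ℕ), n ≠ 0 ∧ a = D.X i ^ n ∧
      comul (R := k) a = a ⊗ₜ 1 + (D.ι (E.g i) ^ n) ⊗ₜ a ∧
      counit (R := k) a = 0 := by
  obtain ⟨i, n, hn, rfl⟩ := ha
  rw [N] at hn
  split_ifs at hn with h
  · obtain rfl : n = orderOf (E.q i i) := by exact_mod_cast hn
    refine ⟨i, _, by omega, rfl, ?_, by simp [counit_X, show orderOf (E.q i i) ≠ 0 by omega]⟩
    rw [Bialgebra.comul_pow, D.comul_X, add_pow_orderOf (E.q i i) h]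
    · simp [Algebra.TensorProduct.tmul_pow]
    · simp [D.X_mul_ι, q, TensorProduct.smul_tmul']
  · exact absurd hn (by simp)

/-- The ideal is a Hopf ideal, so that the quotient by it is a Hopf algebra. -/
instance : D.ideal.IsHopfIdeal k where
  counit_eq_zero := by
    have h : TwoSidedIdeal.span D.powers ≤ TwoSidedIdeal.ker (Bialgebra.counitAlgHom k A) := by
      rw [TwoSidedIdeal.span_le]
      intro a ha
      obtain ⟨i, n, -, -, -, h⟩ := powers_spec ha
      exact (TwoSidedIdeal.mem_ker _).mpr h
    intro x hx
    exact (TwoSidedIdeal.mem_ker (Bialgebra.counitAlgHom k A)).mp (h hx)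
  map_mkQ_comul_eq_zero := by
    let f : A →ₐ[k] (A ⧸ D.ideal) ⊗[k] (A ⧸ D.ideal) :=
      (Algebra.TensorProduct.map (Ideal.Quotient.mkₐ k D.ideal)
        (Ideal.Quotient.mkₐ k D.ideal)).comp (Bialgebra.comulAlgHom k A)
    have h : TwoSidedIdeal.span D.powers ≤ TwoSidedIdeal.ker f := by
      rw [TwoSidedIdeal.span_le]
      intro a ha
      have h0 : Ideal.Quotient.mk D.ideal a = 0 :=
        Ideal.Quotient.eq_zero_iff_mem.mpr (TwoSidedIdeal.subset_span ha)
      obtain ⟨i, n, -, -, h, -⟩ := powers_spec ha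
      rw [SetLike.mem_coe, TwoSidedIdeal.mem_ker]
      simp [f, h, h0]
    intro x hx
    exact (TwoSidedIdeal.mem_ker f).mp (h hx)
  antipode_mem := by
    let f : A →ₐ[k] (A ⧸ D.ideal)ᵐᵒᵖ :=
      (AlgHom.op (Ideal.Quotient.mkₐ k D.ideal)).comp (HopfAlgebra.antipodeAlgHomOp k A)
    have h : TwoSidedIdeal.span D.powers ≤ TwoSidedIdeal.ker f := by
      rw [TwoSidedIdeal.span_le]
      intro a ha
      have h0 : Ideal.Quotient.mk D.ideal a = 0 :=
        Ideal.Quotient.eq_zero_iff_mem.mpr (TwoSidedIdeal.subset_span ha)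
      obtain ⟨i, n, -, -, h, h1⟩ := powers_spec ha
      have h2 := HopfAlgebra.mul_antipode_rTensor_comul_apply (R := k) a
      rw [h, h1] at h2
      simp only [map_add, LinearMap.rTensor_tmul, LinearMap.mul'_apply, mul_one, map_zero] at h2
      have h3 : Ideal.Quotient.mk D.ideal (HopfAlgebra.antipode k a) = 0 := by
        rw [eq_neg_of_add_eq_zero_left h2, map_neg, map_mul, h0, mul_zero, neg_zero]
      exact (TwoSidedIdeal.mem_ker f).mpr (congrArg MulOpposite.op h3)
    intro x hx
    have h4 : f x = 0 := (TwoSidedIdeal.mem_ker f).mp (h hx)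
    exact Ideal.Quotient.eq_zero_iff_mem.mp (MulOpposite.op_injective h4)

variable (D)

/-- The quotient Hopf algebra `H(G, g_i, χ_i)` of `A`. -/
abbrev H : Type _ := A ⧸ D.ideal

/-- The grading of the quotient induced by that of `A`. -/
def gradingH (n : ℕ) : Submodule k D.H :=
  (D.deg n).map (Ideal.Quotient.mkₐ k D.ideal).toLinearMap

end System
end System

end ESC

universe u v w x

/-! Every algebra involved is a `Realization`: it contains images of `G` and of the `X i` obeying
the same q-commutation relations. When these generate, the algebra is spanned by words `h X_{i_1} ⋯
X_{i_n}`. The proof compares the words of `A` with those of `kQᶜ`, where `X i` is the arrow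
`a_{1,i}`.

Since `A` need not be presented by the relations, a homomorphism `A → kQᶜ` cannot be read off from
the generators. Instead, every linear relation between words of `A` is shown to hold in `kQᶜ`
(`IsHopf.exists_algHom_coPath`). On `kQᶜ`, removing a first arrow with label `i` (`strip`) is a skew
derivation. On `A`, contracting the comultiplication with the functional that is `1` on the `h X_i`
and `0` on all other words obeys the same rule; this functional exists because `A` is graded. So
both operations act compatibly on words. An element of `kQᶜ` vanishes once all its iterated strips
have zero vertex coefficients, and on words these coefficients are computed by functionals on `A`.

If `w` does not involve `X_i`, then in `kQᶜ` stripping `X_i^{n+1} w` gives `(1 + q + ⋯ + q^n) g_i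
X_i^n w` with `q = χ_i(g_i)` (`strip_pow_mul`). This q-integer is zero when `n + 1 = N_i` and
nonzero when `n + 1 < N_i`; for `q = 1` the latter needs characteristic zero. Hence `X_i^{N_i} = 0`
in `kQᶜ`, so the map factors through `H`. Moreover, reduced words, in which each `i` occurs less
than `N_i` times, have nonzero images. Multiplication by arrows only rearranges labels, so words
with different group elements or different label multisets are supported on disjoint sets of paths.
The images of the reduced words, one for each multiset, are therefore linearly independent
(`coPath_linearIndependent`). Conversely, reordering costs only invertible scalars, so these words
span `H` (`Generates.span_reduced`). Thus `H` embeds into `kQᶜ`, and its image is the multiple Taft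
algebra.

Compatibility with the Hopf structures is checked on generators, and both gradings come from path
length. For existence, the presented algebra receives its Hopf structure through its universal
property and its grading from `X_i ↦ X_i t`; the independence conditions are pulled back from `kQᶜ`.
-/

namespace ESC

/-! ### Words in the generators, reordering and reduced words. -/

section Realization
variable {k G J : Type*} [Field k] [Group G]

/-- Elements `ι h`, for `h` in `G`, and `X i`, for `i : J`, of an algebra which satisfy the defining
relations `ESC.Rel`. -/
@[ext]
structure Realization (E : ESC k G J) (B : Type*) [Ring B] [Algebra k B] where
  ι : G →* B
  X : J → B
  X_mul_ι : ∀ j h, X j * ι h = (E.χ j h : k) • (ι h * X j)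
  X_mul_X : ∀ i j, i ≠ j → X j * X i = (E.χ j (E.g i) : k) • (X i * X j)

namespace Realization
variable {E : ESC k G J} {B C : Type*} [Ring B] [Algebra k B] [Ring C] [Algebra k C]
  (R : E.Realization B)

/-- The product of the `X i` over a list of indices. -/
def mon (v : List J) : B := (v.map R.X).prod

/-- The product of an element of the group with a monomial in the `X i`. -/
def word (h : G) (v : List J) : B := R.ι h * R.mon v

/-- The span of the words of length `n`. -/
def deg (n : ℕ) : Submodule k B :=
  Submodule.span k {a | ∃ (h : G) (v : List J), v.length = n ∧ a = R.word h v}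

/-- The image of a realization under a homomorphism of algebras. -/
def map (f : B →ₐ[k] C) : E.Realization C where
  ι := (f : B →* C).comp R.ι
  X i := f (R.X i)
  X_mul_ι j h := by
    have := congrArg f (R.X_mul_ι j h)
    simpa using this
  X_mul_X i j hij := by
    have := congrArg f (R.X_mul_X i j hij)
    simpa using this

@[simp] lemma map_ι (f : B →ₐ[k] C) (h : G) : (R.map f).ι h = f (R.ι h) := rfl
@[simp] lemma map_X (f : B →ₐ[k] C) (i : J) : (R.map f).X i = f (R.X i) := rfl

@[simp] lemma mon_nil : R.mon [] = 1 := rfl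

@[simp] lemma mon_cons (i : J) (v : List J) : R.mon (i :: v) = R.X i * R.mon v := by simp [mon]

@[simp] lemma mon_append (v w : List J) : R.mon (v ++ w) = R.mon v * R.mon w := by simp [mon]

@[simp] lemma mon_replicate (n : ℕ) (i : J) : R.mon (List.replicate n i) = R.X i ^ n := by
  simp [mon]

lemma map_mon (f : B →ₐ[k] C) (v : List J) : (R.map f).mon v = f (R.mon v) := by
  simp only [mon, map_list_prod, List.map_map]; rfl

lemma map_word (f : B →ₐ[k] C) (h : G) (v : List J) : (R.map f).word h v = f (R.word h v) := by
  simp [word, map_mon]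

lemma map_deg (f : B →ₐ[k] C) (n : ℕ) : (R.map f).deg n = (R.deg n).map f.toLinearMap := by
  rw [deg, deg, Submodule.map_span]
  congr 1
  ext a
  constructor
  · rintro ⟨h, v, hv, rfl⟩; exact ⟨_, ⟨h, v, hv, rfl⟩, (R.map_word f h v).symm⟩
  · rintro ⟨_, ⟨h, v, hv, rfl⟩, rfl⟩; exact ⟨h, v, hv, (R.map_word f h v).symm⟩

variable (E) in
/-- The product of the characters `χ i` over a list of indices. -/
def chars (v : List J) : G →* kˣ := (v.map E.χ).prod

lemma mon_mul_ι (v : List J) (h : G) :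
    R.mon v * R.ι h = (chars E v h : k) • (R.ι h * R.mon v) := by
  induction v with
  | nil => simp [chars]
  | cons i v ih =>
    rw [mon_cons, mul_assoc, ih, mul_smul_comm, ← mul_assoc, X_mul_ι, smul_mul_assoc, smul_smul,
      mul_assoc]
    congr 1
    simp [chars, mul_comm]

lemma word_mul_word (h h' : G) (v v' : List J) :
    R.word h v * R.word h' v' = (chars E v h' : k) • R.word (h * h') (v ++ v') := by
  rw [word, word, mul_assoc, ← mul_assoc (R.mon v), mon_mul_ι]
  simp [word, mul_assoc]

lemma ι_mul_word (h h' : G) (v : List J) : R.ι h * R.word h' v = R.word (h * h') v := by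
  simp [word, mul_assoc]

lemma X_mul_word (i : J) (h : G) (v : List J) :
    R.X i * R.word h v = (E.χ i h : k) • R.word h (i :: v) := by
  rw [word, ← mul_assoc, X_mul_ι, smul_mul_assoc, word, mon_cons, mul_assoc]

lemma word_mem_deg (h : G) (v : List J) : R.word h v ∈ R.deg v.length :=
  Submodule.subset_span ⟨h, v, rfl, rfl⟩

lemma one_mem_deg : (1 : B) ∈ R.deg 0 := by
  simpa [word] using R.word_mem_deg 1 []

lemma ι_mem_deg (h : G) : R.ι h ∈ R.deg 0 := by
  simpa [word] using R.word_mem_deg h []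

lemma X_mem_deg (i : J) : R.X i ∈ R.deg 1 := by
  simpa [word] using R.word_mem_deg 1 [i]

lemma mul_mem_deg {m n : ℕ} {a b : B} (ha : a ∈ R.deg m) (hb : b ∈ R.deg n) :
    a * b ∈ R.deg (m + n) := by
  have : R.deg m * R.deg n ≤ R.deg (m + n) := by
    rw [deg, deg, Submodule.span_mul_span, Submodule.span_le]
    rintro _ ⟨_, ⟨h, v, rfl, rfl⟩, _, ⟨h', v', rfl, rfl⟩, rfl⟩
    change R.word h v * R.word h' v' ∈ _
    rw [word_mul_word, ← List.length_append]
    exact Submodule.smul_mem _ _ (R.word_mem_deg _ _)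
  exact this (Submodule.mul_mem_mul ha hb)

/-- A property of elements of degree `n` which is compatible with sums and scalar multiples can be
proved by adding one factor on the left at a time. -/
lemma deg_induction {p : ∀ (n : ℕ) (a : B), a ∈ R.deg n → Prop} (one : p 0 1 R.one_mem_deg)
    (ι_mul : ∀ n h a (ha : a ∈ R.deg n), p n a ha →
      p n (R.ι h * a) (n.zero_add ▸ R.mul_mem_deg (R.ι_mem_deg h) ha))
    (X_mul : ∀ n i a (ha : a ∈ R.deg n), p n a ha →
      p (n + 1) (R.X i * a) (n.add_comm 1 ▸ R.mul_mem_deg (R.X_mem_deg i) ha))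
    (zero : ∀ n, p n 0 (zero_mem _))
    (add : ∀ n a b (ha : a ∈ R.deg n) (hb : b ∈ R.deg n), p n a ha → p n b hb →
      p n (a + b) (add_mem ha hb))
    (smul : ∀ n (c : k) a (ha : a ∈ R.deg n), p n a ha →
      p n (c • a) (Submodule.smul_mem _ c ha)) {n : ℕ} {a : B} (ha : a ∈ R.deg n) : p n a ha := by
  induction ha using Submodule.span_induction with
  | mem a ha =>
    obtain ⟨h, v, rfl, rfl⟩ := ha
    have hmem : ∀ v, R.mon v ∈ R.deg v.length := fun v => by simpa [word] using R.word_mem_deg 1 v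
    refine ι_mul _ _ _ (hmem v) ?_
    induction v with
    | nil => exact one
    | cons i v ih => simp only [mon_cons]; exact X_mul _ _ _ (hmem v) ih
  | zero => exact zero n
  | add a b ha' hb' ha hb => exact add n a b ha' hb' ha hb
  | smul c a ha' ha => exact smul n c a ha' ha

/-- The elements of `G` and the `X i` generate the algebra. -/
def Generates : Prop := Algebra.adjoin k (Set.range R.ι ∪ Set.range R.X) = ⊤

variable {R}

/-- Multiplying by one generator at a time on the left suffices, so no closure of `p` under general
products is required. -/
lemma Generates.induction (hR : R.Generates) {p : B → Prop} (one : p 1)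
    (ι_mul : ∀ h a, p a → p (R.ι h * a)) (X_mul : ∀ i a, p a → p (R.X i * a))
    (add : ∀ a b, p a → p b → p (a + b)) (smul : ∀ (c : k) a, p a → p (c • a)) (a : B) : p a := by
  -- Strengthened to preservation of `p` under left multiplication by `a`, a condition which is
  -- stable under products.
  have h : ∀ a ∈ Algebra.adjoin k (Set.range R.ι ∪ Set.range R.X), ∀ b, p b → p (a * b) := by
    intro a ha
    induction ha using Algebra.adjoin_induction with
    | mem a ha =>
      obtain ⟨h, rfl⟩ | ⟨i, rfl⟩ := ha
      · exact ι_mul h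
      · exact X_mul i
    | algebraMap r => intro b hb; rw [← Algebra.smul_def]; exact smul r b hb
    | add x y _ _ hx hy => intro b hb; rw [add_mul]; exact add _ _ (hx b hb) (hy b hb)
    | mul x y _ _ hx hy => intro b hb; rw [mul_assoc]; exact hx _ (hy b hb)
  simpa using h a (by rw [hR]; trivial) 1 one

/-- Left multiplication by a generator sends a word to a scalar multiple of a word. -/
lemma Generates.span_word (hR : R.Generates) :
    Submodule.span k (Set.range fun p : G × List J => R.word p.1 p.2) = ⊤ := by
  rw [Submodule.eq_top_iff']
  intro a
  refine hR.induction ?_ (fun h a ha => ?_) (fun i a ha => ?_)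
    (fun _ _ => add_mem) (fun c _ => Submodule.smul_mem _ c) a
  · exact Submodule.subset_span ⟨(1, []), by simp [word]⟩
  · induction ha using Submodule.span_induction with
    | mem a ha =>
      obtain ⟨⟨h', v⟩, rfl⟩ := ha
      exact Submodule.subset_span ⟨(h * h', v), (R.ι_mul_word h h' v).symm⟩
    | zero => simp
    | add x y _ _ hx hy => rw [mul_add]; exact add_mem hx hy
    | smul c x _ hx => rw [mul_smul_comm]; exact Submodule.smul_mem _ _ hx
  · induction ha using Submodule.span_induction with
    | mem a ha =>
      obtain ⟨⟨h', v⟩, rfl⟩ := ha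
      simp only [X_mul_word]
      exact Submodule.smul_mem _ _ (Submodule.subset_span ⟨(h', i :: v), rfl⟩)
    | zero => simp
    | add x y _ _ hx hy => rw [mul_add]; exact add_mem hx hy
    | smul c x _ hx => rw [mul_smul_comm]; exact Submodule.smul_mem _ _ hx

lemma Generates.iSup_deg (hR : R.Generates) : ⨆ n, R.deg n = ⊤ := by
  rw [eq_top_iff, ← hR.span_word, Submodule.span_le]
  rintro _ ⟨⟨h, v⟩, rfl⟩
  exact Submodule.mem_iSup_of_mem v.length (R.word_mem_deg h v)

/-- If there are linear maps `pr n`, injective in degree `n` and vanishing in all other degrees, then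
the sum of the homogeneous components is direct. -/
lemma Generates.isInternal_deg (hR : R.Generates) {M : Type*} [AddCommGroup M] [Module k M]
    (pr : ℕ → B →ₗ[k] M) (hpr : ∀ n h v, v.length ≠ n → pr n (R.word h v) = 0)
    (hinj : ∀ n, ∀ a ∈ R.deg n, pr n a = 0 → a = 0) : DirectSum.IsInternal R.deg := by
  rw [DirectSum.isInternal_submodule_iff_iSupIndep_and_iSup_eq_top]
  refine ⟨?_, hR.iSup_deg⟩
  intro n
  rw [Submodule.disjoint_def]
  intro a ha ha'
  refine hinj n a ha ?_
  suffices h : ⨆ m, ⨆ (_ : m ≠ n), R.deg m ≤ LinearMap.ker (pr n) from h ha'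
  refine iSup₂_le fun m hm => Submodule.span_le.mpr ?_
  rintro _ ⟨h, v, rfl, rfl⟩
  exact hpr n h v hm

lemma Generates.map (hR : R.Generates) {f : B →ₐ[k] C} (hf : Function.Surjective f) :
    (R.map f).Generates := by
  have h := AlgHom.map_adjoin f (Set.range R.ι ∪ Set.range R.X)
  rw [show Algebra.adjoin k (Set.range R.ι ∪ Set.range R.X) = ⊤ from hR, Algebra.map_top,
    (AlgHom.range_eq_top f).mpr hf, Set.image_union, ← Set.range_comp, ← Set.range_comp] at h
  exact h.symm

lemma Generates.algHom_ext (hR : R.Generates) {f f' : B →ₐ[k] C} (h1 : ∀ h, f (R.ι h) = f' (R.ι h))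
    (h2 : ∀ i, f (R.X i) = f' (R.X i)) : f = f' := by
  refine AlgHom.ext_of_adjoin_eq_top hR ?_
  rintro _ (⟨h, rfl⟩ | ⟨i, rfl⟩)
  · exact h1 h
  · exact h2 i

variable (R)

/-- Reordering the factors of a monomial in the `X i` changes it by an invertible scalar. -/
lemma mon_perm {v w : List J} (h : v.Perm w) : ∃ c : kˣ, R.mon v = c • R.mon w := by
  induction h with
  | nil => exact ⟨1, by simp⟩
  | cons i _ ih =>
    obtain ⟨c, hc⟩ := ih
    exact ⟨c, by rw [mon_cons, mon_cons, hc, mul_smul_comm]⟩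
  | swap i j v =>
    by_cases hij : i = j
    · exact ⟨1, by simp [hij]⟩
    · refine ⟨E.χ j (E.g i), ?_⟩
      rw [mon_cons, mon_cons, ← mul_assoc, R.X_mul_X i j hij, mon_cons, mon_cons, smul_mul_assoc,
        mul_assoc]
      rfl
  | trans _ _ ih1 ih2 =>
    obtain ⟨c, hc⟩ := ih1
    obtain ⟨d, hd⟩ := ih2
    exact ⟨c * d, by rw [hc, hd, smul_smul]⟩

/-- Monomials with too many factors `X i` vanish if a power of `X i` does. -/
lemma mon_eq_zero [DecidableEq J] {v : List J} {i : J} {n : ℕ} (hX : R.X i ^ n = 0)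
    (hv : n ≤ v.count i) : R.mon v = 0 := by
  obtain ⟨w, hw⟩ := (List.replicate_sublist_iff.mpr hv).exists_perm_append
  obtain ⟨c, hc⟩ := R.mon_perm hw
  rw [hc, mon_append, mon_replicate, hX, zero_mul, smul_zero]

variable (E) in
/-- The multisets of indices in which every index `i` occurs less than `N i` times. -/
def Reduced [DecidableEq J] : Set (Multiset J) := {m | ∀ i, (m.count i : ℕ∞) < E.N i}

variable {R} in
-- A word is an invertible multiple of the word with its labels in the chosen order of their
-- multiset, and it vanishes if some label occurs too often. This is the upper bound for the size of
-- `H`.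
lemma Generates.span_reduced [DecidableEq J] (hR : R.Generates)
    (hX : ∀ (i : J) (n : ℕ), (n : ℕ∞) = E.N i → R.X i ^ n = 0) :
    Submodule.span k (Set.range fun p : G × Reduced E => R.word p.1 (p.2 : Multiset J).toList) =
      ⊤ := by
  rw [eq_top_iff, ← hR.span_word, Submodule.span_le]
  rintro _ ⟨⟨h, v⟩, rfl⟩
  by_cases hv : (v : Multiset J) ∈ Reduced E
  · obtain ⟨c, hc⟩ := R.mon_perm (Multiset.coe_eq_coe.mp (Multiset.coe_toList (v : Multiset J))).symm
    change R.word h v ∈ _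
    rw [word, hc, mul_smul_comm]
    exact Submodule.smul_mem _ (c : k) (Submodule.subset_span ⟨(h, ⟨v, hv⟩), rfl⟩)
  · simp only [Reduced, Set.mem_ofPred_eq, not_forall, not_lt, Multiset.coe_count] at hv
    obtain ⟨i, hi⟩ := hv
    -- `N i` is bounded by a count, hence finite, so the power of `X i` that vanishes is available.
    obtain ⟨n, hn⟩ := ENat.ne_top_iff_exists.mp (ne_top_of_le_ne_top (ENat.natCast_ne_top _) hi)
    rw [← hn] at hi
    change R.word h v ∈ _
    rw [word, R.mon_eq_zero (hX i n hn) (by exact_mod_cast hi), mul_zero]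
    exact zero_mem _

end Realization
end Realization
end ESC

namespace ESC

/-! ### Hopf structure maps and degrees, controlled by the generators. -/

section GradedHopf
variable {k G J : Type*} [Field k] [Group G]

namespace Realization
variable {E : ESC k G J} {B : Type*} [Ring B] [HopfAlgebra k B] (R : E.Realization B)

/-- The elements of `G` are group-like and the `X i` are `(1, g i)`-primitive. -/
structure IsHopf (R : E.Realization B) : Prop where
  isGroupLikeElem_ι : ∀ h, IsGroupLikeElem k (R.ι h)
  comul_X : ∀ j, comul (R := k) (R.X j) = R.X j ⊗ₜ 1 + R.ι (E.g j) ⊗ₜ R.X j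

/-- The elements of degree `n` of the tensor square. -/
def degTensor (n : ℕ) : Submodule k (B ⊗[k] B) :=
  ⨆ p ∈ Finset.HasAntidiagonal.antidiagonal n,
    LinearMap.range (TensorProduct.map (R.deg p.1).subtype (R.deg p.2).subtype)

lemma tmul_mem_degTensor {m n : ℕ} {a b : B} (ha : a ∈ R.deg m) (hb : b ∈ R.deg n) :
    a ⊗ₜ[k] b ∈ R.degTensor (m + n) := by
  refine Submodule.mem_iSup_of_mem (m, n) (Submodule.mem_iSup_of_mem (by simp) ?_)
  exact ⟨⟨a, ha⟩ ⊗ₜ ⟨b, hb⟩, by simp⟩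

lemma degTensor_induction {n : ℕ} {p : B ⊗[k] B → Prop}
    (tmul : ∀ i j a b, i + j = n → a ∈ R.deg i → b ∈ R.deg j → p (a ⊗ₜ b)) (zero : p 0)
    (add : ∀ a b, p a → p b → p (a + b)) {t : B ⊗[k] B} (ht : t ∈ R.degTensor n) : p t := by
  rw [degTensor] at ht
  induction ht using Submodule.iSup_induction' with
  | mem q t ht =>
    by_cases hq : q ∈ Finset.HasAntidiagonal.antidiagonal n
    · simp only [hq, iSup_pos] at ht
      obtain ⟨t, rfl⟩ := ht
      induction t with
      | zero => simpa using zero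
      | add a b ha hb => rw [map_add]; exact add _ _ ha hb
      | tmul a b => exact tmul q.1 q.2 _ _ (by simpa using hq) a.2 b.2
    · simp only [hq, iSup_neg, Submodule.mem_bot, not_false_eq_true] at ht
      rw [ht]; exact zero
  | zero => exact zero
  | add a b _ _ ha hb => exact add a b ha hb

lemma tmul_mul_mem_degTensor {l m n : ℕ} {a b : B} {t : B ⊗[k] B} (ha : a ∈ R.deg l)
    (hb : b ∈ R.deg m) (ht : t ∈ R.degTensor n) : a ⊗ₜ b * t ∈ R.degTensor (l + m + n) := by
  refine R.degTensor_induction (p := fun t => a ⊗ₜ b * t ∈ R.degTensor (l + m + n))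
    (fun i j c d hij hc hd => ?_) ?_ (fun _ _ h h' => ?_) ht
  · rw [Algebra.TensorProduct.tmul_mul_tmul, ← hij, add_add_add_comm]
    exact R.tmul_mem_degTensor (R.mul_mem_deg ha hc) (R.mul_mem_deg hb hd)
  · simp
  · rw [mul_add]; exact add_mem h h'

variable {R}

/-- Applying `ε ⊗ id` to the comultiplication of `X j` gives `X j = ε(X j) 1 + X j`, and `1 ≠ 0`. -/
lemma IsHopf.counit_X (hR : R.IsHopf) (j : J) : counit (R := k) (R.X j) = 0 := by
  have := Bialgebra.nontrivial k (A := B)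
  have h := congrArg (fun t => TensorProduct.lid k B (counit.rTensor B t)) (hR.comul_X j)
  simp only [Coalgebra.rTensor_counit_comul] at h
  simpa [(hR.isGroupLikeElem_ι _).counit_eq_one, Algebra.algebraMap_eq_smul_one] using h

lemma IsHopf.antipode_ι (hR : R.IsHopf) (h : G) :
    HopfAlgebra.antipode k (R.ι h) = R.ι h⁻¹ := by
  have h1 := HopfAlgebra.mul_antipode_rTensor_comul_apply (R := k) (R.ι h)
  rw [(hR.isGroupLikeElem_ι h).comul_eq_tmul_self, (hR.isGroupLikeElem_ι h).counit_eq_one] at h1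
  simp only [LinearMap.rTensor_tmul, LinearMap.mul'_apply, map_one] at h1
  calc _ = HopfAlgebra.antipode k (R.ι h) * (R.ι h * R.ι h⁻¹) := by rw [← map_mul]; simp
    _ = _ := by rw [← mul_assoc, h1, one_mul]

lemma IsHopf.antipode_X (hR : R.IsHopf) (j : J) :
    HopfAlgebra.antipode k (R.X j) = -(R.ι (E.g j)⁻¹ * R.X j) := by
  have h1 := HopfAlgebra.mul_antipode_rTensor_comul_apply (R := k) (R.X j)
  rw [hR.comul_X, hR.counit_X] at h1
  simp only [map_add, LinearMap.rTensor_tmul, LinearMap.mul'_apply, mul_one, map_zero,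
    hR.antipode_ι] at h1
  exact eq_neg_of_add_eq_zero_left h1

/-- The coproduct of a generator is homogeneous of the degree of that generator, and degrees in the
tensor square add under products. -/
lemma IsHopf.comul_mem (hR : R.IsHopf) {n : ℕ} {a : B} (ha : a ∈ R.deg n) :
    comul (R := k) a ∈ R.degTensor n := by
  induction ha using R.deg_induction with
  | one =>
    rw [Bialgebra.comul_one, Algebra.TensorProduct.one_def]
    have h := R.tmul_mem_degTensor R.one_mem_deg R.one_mem_deg
    rwa [add_zero] at h
  | ι_mul n h a _ ih =>
    rw [Bialgebra.comul_mul, (hR.isGroupLikeElem_ι h).comul_eq_tmul_self]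
    have := R.tmul_mul_mem_degTensor (R.ι_mem_deg h) (R.ι_mem_deg h) ih
    rwa [zero_add, zero_add] at this
  | X_mul n i a _ ih =>
    rw [Bialgebra.comul_mul, hR.comul_X, add_mul]
    have h1 := R.tmul_mul_mem_degTensor (R.X_mem_deg i) R.one_mem_deg ih
    have h2 := R.tmul_mul_mem_degTensor (R.ι_mem_deg (E.g i)) (R.X_mem_deg i) ih
    rw [add_zero, add_comm] at h1
    rw [zero_add, add_comm] at h2
    exact add_mem h1 h2
  | zero n => rw [map_zero]; exact zero_mem _
  | add n a b _ _ ha hb => rw [map_add]; exact add_mem ha hb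
  | smul n c a _ ha => rw [map_smul]; exact Submodule.smul_mem _ _ ha

lemma IsHopf.counit_eq_zero (hR : R.IsHopf) {n : ℕ} {a : B} (ha : a ∈ R.deg n) (hn : n ≠ 0) :
    counit (R := k) a = 0 := by
  induction ha using R.deg_induction with
  | one => exact absurd rfl hn
  | ι_mul n h a _ ih => rw [Bialgebra.counit_mul, ih hn, mul_zero]
  | X_mul n i a _ ih => rw [Bialgebra.counit_mul, hR.counit_X, zero_mul]
  | zero n => rw [map_zero]
  | add n a b _ _ ha hb => rw [map_add, ha hn, hb hn, add_zero]
  | smul n c a _ ha => rw [map_smul, ha hn, smul_zero]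

lemma IsHopf.antipode_mem (hR : R.IsHopf) {n : ℕ} {a : B} (ha : a ∈ R.deg n) :
    HopfAlgebra.antipode k a ∈ R.deg n := by
  induction ha using R.deg_induction with
  | one => rw [HopfAlgebra.antipode_one]; exact R.one_mem_deg
  | ι_mul n h a _ ih =>
    rw [HopfAlgebra.antipode_mul_antidistrib, hR.antipode_ι]
    have h := R.mul_mem_deg ih (R.ι_mem_deg h⁻¹)
    rwa [add_zero] at h
  | X_mul n i a _ ih =>
    rw [HopfAlgebra.antipode_mul_antidistrib, hR.antipode_X]
    refine R.mul_mem_deg ih (neg_mem ?_)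
    simpa using R.mul_mem_deg (R.ι_mem_deg (E.g i)⁻¹) (R.X_mem_deg i)
  | zero n => rw [map_zero]; exact zero_mem _
  | add n a b _ _ ha hb => rw [map_add]; exact add_mem ha hb
  | smul n c a _ ha => rw [map_smul]; exact Submodule.smul_mem _ _ ha

lemma IsHopf.isGradedHopf (hR : R.IsHopf) (h : DirectSum.IsInternal R.deg) :
    IsGradedHopf k R.deg where
  isInternal := h
  one_mem := R.one_mem_deg
  mul_mem _ _ _ ha _ hb := R.mul_mem_deg ha hb
  comul_mem _ _ ha := hR.comul_mem ha
  counit_eq_zero _ hn _ ha := hR.counit_eq_zero ha hn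
  antipode_mem _ _ ha := hR.antipode_mem ha

variable {C : Type*} [Ring C] [HopfAlgebra k C]

lemma IsHopf.map (hR : R.IsHopf) (f : B →ₐc[k] C) :
    (R.map (f : B →ₐ[k] C)).IsHopf where
  isGroupLikeElem_ι h := (hR.isGroupLikeElem_ι h).map f
  comul_X j := by
    have h := CoalgHomClass.map_comp_comul_apply f (R.X j)
    rw [hR.comul_X] at h
    simpa using h.symm

/-- A homomorphism of algebras between Hopf algebras which are generated by group-like and
skew-primitive elements is a homomorphism of bialgebras as soon as it preserves these. -/
def IsHopf.bialgHom (hR : R.IsHopf) (hg : R.Generates) (f : B →ₐ[k] C) (hf : (R.map f).IsHopf) :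
    B →ₐc[k] C :=
  BialgHom.ofAlgHom f
    (hg.algHom_ext
      (fun h => by
        simpa [(hR.isGroupLikeElem_ι h).counit_eq_one] using (hf.isGroupLikeElem_ι h).counit_eq_one)
      (fun i => by simpa [hR.counit_X] using hf.counit_X i))
    (hg.algHom_ext
      (fun h => by
        simpa [(hR.isGroupLikeElem_ι h).comul_eq_tmul_self] using
          (hf.isGroupLikeElem_ι h).comul_eq_tmul_self.symm)
      (fun i => by simpa [hR.comul_X] using (hf.comul_X i).symm))

/-- Antipodes are anti-multiplicative, and their values on group-like and skew-primitive generators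
are forced, so both sides agree on generators and then everywhere. -/
lemma IsHopf.map_antipode (hR : R.IsHopf) (hg : R.Generates) (f : B →ₐc[k] C) (a : B) :
    f (HopfAlgebra.antipode k a) = HopfAlgebra.antipode k (f a) := by
  have hf := hR.map f
  refine hg.induction (p := fun a => f (HopfAlgebra.antipode k a) = HopfAlgebra.antipode k (f a))
    (by simp) (fun h a ih => ?_) (fun i a ih => ?_) (fun a b ha hb => ?_) (fun c a ha => ?_) a
  · have h1 : HopfAlgebra.antipode k (f (R.ι h)) = f (R.ι h⁻¹) := hf.antipode_ι h
    rw [HopfAlgebra.antipode_mul_antidistrib, hR.antipode_ι, map_mul, map_mul,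
      HopfAlgebra.antipode_mul_antidistrib, h1, ih]
  · have h1 : HopfAlgebra.antipode k (f (R.X i)) = -(f (R.ι (E.g i)⁻¹) * f (R.X i)) :=
      hf.antipode_X i
    rw [HopfAlgebra.antipode_mul_antidistrib, hR.antipode_X, map_mul, map_mul,
      HopfAlgebra.antipode_mul_antidistrib, h1, ih, map_neg, map_mul]
  · simp only [map_add, ha, hb]
  · simp only [map_smul, ha]

end Realization
end GradedHopf
end ESC

namespace ESC

/-! ### Words in the co-path Hopf algebra: stripping first arrows and q-integers. -/

section CoPathWords
variable {k G J : Type*} [Field k] [Group G] {E : ESC k G J}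

variable (E) in
/-- The coefficient of a path. -/
noncomputable def coeff (x : G) (v : List J) : E.CoPath →ₗ[k] k :=
  (Finsupp.lapply (x, v) : ((G × List J) →₀ k) →ₗ[k] k)

lemma coeff_path_self (x : G) (v : List J) : E.coeff x v (E.path x v) = 1 :=
  Finsupp.single_eq_same

lemma coeff_path_of_ne {x y : G} {v w : List J} (h : (y, w) ≠ (x, v)) :
    E.coeff x v (E.path y w) = 0 := Finsupp.single_eq_of_ne h.symm

lemma ext_coeff {a b : E.CoPath} (h : ∀ x v, E.coeff x v a = E.coeff x v b) : a = b :=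
  Finsupp.ext fun p : G × List J => h p.1 p.2

open Classical in
variable (E) in
/-- The linear map removing the first arrow of a path if its label is `i`, and annihilating all
other paths. -/
noncomputable def strip (i : J) : E.CoPath →ₗ[k] E.CoPath :=
  E.lin fun x v => match v with
    | [] => 0
    | j :: w => if j = i then E.path (E.g i * x) w else 0

@[simp] lemma strip_nil (i : J) (x : G) : E.strip i (E.path x []) = 0 := by simp [strip]

lemma strip_cons (i : J) (x : G) (v : List J) :
    E.strip i (E.path x (i :: v)) = E.path (E.g i * x) v := by simp [strip]

lemma strip_cons_of_ne {i j : J} (h : j ≠ i) (x : G) (v : List J) :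
    E.strip i (E.path x (j :: v)) = 0 := by simp [strip, h]

/-- Repeated use turns any coefficient into a vertex coefficient of an iterated strip. -/
lemma coeff_strip (i : J) (x : G) (v : List J) (a : E.CoPath) :
    E.coeff (E.g i * x) v (E.strip i a) = E.coeff x (i :: v) a := by
  suffices h : E.coeff (E.g i * x) v ∘ₗ E.strip i = E.coeff x (i :: v) from
    LinearMap.congr_fun h a
  refine hom_ext fun y w => ?_
  rw [LinearMap.comp_apply]
  cases w with
  | nil => rw [strip_nil, map_zero, coeff_path_of_ne (by simp)]
  | cons j w =>
    by_cases hj : j = i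
    · subst hj
      rw [strip_cons]
      by_cases h : (y, w) = (x, v)
      · obtain ⟨rfl, rfl⟩ := Prod.mk.inj h
        rw [coeff_path_self, coeff_path_self]
      · rw [coeff_path_of_ne (by simpa using h), coeff_path_of_ne (by simpa using h)]
    · rw [strip_cons_of_ne hj, map_zero, coeff_path_of_ne (by simp [hj])]

/-- A path is a vertex or begins with an arrow, so the vertex coefficients and the strips together
contain every coefficient. -/
lemma eq_zero_of_strip {a : E.CoPath} (h0 : ∀ x, E.coeff x [] a = 0)
    (h : ∀ i, E.strip i a = 0) : a = 0 := by
  refine ext_coeff fun x v => ?_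
  rw [map_zero]
  cases v with
  | nil => exact h0 x
  | cons i v => rw [← coeff_strip, h, map_zero]

lemma strip_prep (i : J) (a : E.CoPath) : E.strip i (E.prep i a) = a := by
  suffices h : E.strip i ∘ₗ E.prep i = LinearMap.id from LinearMap.congr_fun h a
  exact hom_ext fun x v => by simp [strip_cons]

lemma strip_prep_of_ne {i j : J} (hij : j ≠ i) (a : E.CoPath) : E.strip i (E.prep j a) = 0 := by
  suffices h : E.strip i ∘ₗ E.prep j = 0 from LinearMap.congr_fun h a
  exact hom_ext fun x v => by simp [strip_cons_of_ne hij]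

lemma vertex_mul_path (x y : G) (v : List J) : E.path x [] * E.path y v = E.path (x * y) v := by
  rw [path_mul_path, mulPath]

lemma strip_vertex_mul (i : J) (x : G) (a : E.CoPath) :
    E.strip i (E.path x [] * a) = E.path x [] * E.strip i a := by
  suffices h : E.strip i ∘ₗ E.mulHom (E.path x []) = E.mulHom (E.path x []) ∘ₗ E.strip i from
    LinearMap.congr_fun h a
  refine hom_ext fun y w => ?_
  simp only [LinearMap.comp_apply, ← mul_def, vertex_mul_path]
  cases w with
  | nil => simp
  | cons j w =>
    by_cases hj : j = i
    · subst hj; rw [strip_cons, strip_cons, vertex_mul_path, ← mul_assoc, ← comm_g, mul_assoc]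
    · rw [strip_cons_of_ne hj, strip_cons_of_ne hj, mul_zero]

/-- The new arrow is placed either in front of the path or behind its first arrow `j`. The recursor
merges the two cases, giving `0` when there is no first arrow. -/
lemma arrow_mul (i : J) (y : G) (w : List J) : E.path 1 [i] * E.path y w =
    (E.χ i y : k) • E.path y (i :: w) + w.rec 0 fun j w _ =>
      E.prep j (E.path 1 [i] * E.path (E.g j * y) w) := by
  cases w <;> simp [path_mul_path, mulPath]

/-- Skew Leibniz rule: the arrow removed is either the newly inserted one, which leaves the factor
`χ_i` of the start vertex, or the old first arrow. -/
lemma strip_arrow_mul (i : J) (a : E.CoPath) : E.strip i (E.path 1 [i] * a) =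
    E.path (E.g i) [] * E.tw i a + E.path 1 [i] * E.strip i a := by
  suffices h : E.strip i ∘ₗ E.mulHom (E.path 1 [i]) =
      E.mulHom (E.path (E.g i) []) ∘ₗ E.tw i + E.mulHom (E.path 1 [i]) ∘ₗ E.strip i from
    LinearMap.congr_fun h a
  refine hom_ext fun y w => ?_
  simp only [LinearMap.comp_apply, LinearMap.add_apply, ← mul_def]
  rw [arrow_mul, map_add, map_smul, strip_cons, tw_path, mul_smul_comm, vertex_mul_path]
  congr 1
  cases w with
  | nil => simp
  | cons j w =>
    by_cases hj : j = i
    · subst hj; simp only [strip_cons, strip_prep]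
    · simp only [strip_cons_of_ne hj, strip_prep_of_ne hj, mul_zero]

lemma strip_arrow_mul_of_ne {i j : J} (hij : j ≠ i) (a : E.CoPath) :
    E.strip i (E.path 1 [j] * a) = E.path 1 [j] * E.strip i a := by
  suffices h : E.strip i ∘ₗ E.mulHom (E.path 1 [j]) = E.mulHom (E.path 1 [j]) ∘ₗ E.strip i from
    LinearMap.congr_fun h a
  refine hom_ext fun y w => ?_
  simp only [LinearMap.comp_apply, ← mul_def]
  rw [arrow_mul, map_add, map_smul, strip_cons_of_ne hij, smul_zero, zero_add]
  cases w with
  | nil => simp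
  | cons l w =>
    by_cases hl : l = i
    · subst hl; simp only [strip_cons, strip_prep]
    · simp only [strip_cons_of_ne hl, strip_prep_of_ne hl, mul_zero]

/-- The vertices and the arrows starting at `1` satisfy the defining relations. -/
noncomputable def coPathRealization (hE : E.IsQuantumWeaklyCommutative) :
    E.Realization E.CoPath where
  ι :=
    { toFun := fun x => E.path x []
      map_one' := rfl
      map_mul' := fun x y => (vertex_mul_path x y []).symm }
  X i := E.path 1 [i]
  X_mul_ι j h := by
    change E.path 1 [j] * E.path h [] = (E.χ j h : k) • (E.path h [] * E.path 1 [j])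
    rw [arrow_mul, vertex_mul_path]; simp
  X_mul_X i j hij := by
    -- The product `X_j X_i` is the path `[j, i]` plus `χ_j(g_i)` times the path `[i, j]`. Quantum
    -- weak commutativity makes this proportional to the same sum with `i` and `j` exchanged.
    have h : (E.χ j (E.g i) : k) * (E.χ i (E.g j) : k) = 1 := by
      rw [← Units.val_mul, hE j i hij.symm, Units.val_one]
    simp [arrow_mul, smul_smul, h, add_comm]

variable (hE : E.IsQuantumWeaklyCommutative)

lemma coPathRealization_ι (x : G) : (coPathRealization hE).ι x = E.path x [] := rfl
lemma coPathRealization_X (i : J) : (coPathRealization hE).X i = E.path 1 [i] := rfl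

/-- The arrow is inserted at the various positions of the path with scalar coefficients, so the
start vertex stays and the labels are only rearranged. -/
lemma arrow_mul_path_mem (i : J) (y : G) (w : List J) : E.path 1 [i] * E.path y w ∈
    Submodule.span k (E.path y '' {u | u.Perm (i :: w)}) := by
  induction w generalizing y with
  | nil =>
    rw [arrow_mul, add_zero]
    exact Submodule.smul_mem _ _ (Submodule.subset_span ⟨_, List.Perm.refl _, rfl⟩)
  | cons j w ih =>
    rw [arrow_mul]
    refine add_mem (Submodule.smul_mem _ _ (Submodule.subset_span ⟨_, List.Perm.refl _, rfl⟩)) ?_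
    refine (Submodule.map_span_le (E.prep j) _ _).mpr ?_ (Submodule.mem_map_of_mem (ih (E.g j * y)))
    rintro _ ⟨u, hu, rfl⟩
    refine Submodule.subset_span ⟨j :: u, ?_, by simp⟩
    exact ((List.perm_cons j).mpr hu).trans (List.Perm.swap _ _ _)

lemma coPath_word_mem (h : G) (v : List J) : (coPathRealization hE).word h v ∈
    Submodule.span k (E.path h '' {u | u.Perm v}) := by
  have h1 : (coPathRealization hE).mon v ∈ Submodule.span k (E.path 1 '' {u | u.Perm v}) := by
    induction v with
    | nil => exact Submodule.subset_span ⟨[], List.Perm.refl _, rfl⟩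
    | cons i v ih =>
      rw [Realization.mon_cons]
      refine (Submodule.map_span_le (E.mulHom (E.path 1 [i])) _ _).mpr ?_
        (Submodule.mem_map_of_mem ih)
      rintro _ ⟨u, hu, rfl⟩
      refine Submodule.span_mono (Set.image_mono fun w hw => ?_) (arrow_mul_path_mem i 1 u)
      exact List.Perm.trans hw ((List.perm_cons i).mpr hu)
  refine (Submodule.map_span_le (E.mulHom (E.path h [])) _ _).mpr ?_ (Submodule.mem_map_of_mem h1)
  rintro _ ⟨u, hu, rfl⟩
  refine Submodule.subset_span ⟨u, hu, ?_⟩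
  rw [← mul_def, vertex_mul_path, mul_one]

/-- Words with different group elements or different multisets of labels thus have disjoint
supports, which reduces their linear independence to nonvanishing. -/
lemma coeff_coPath_word {x h : G} {u v : List J} (hne : ¬ (h = x ∧ u.Perm v)) :
    E.coeff x u ((coPathRealization hE).word h v) = 0 := by
  refine (Submodule.span_le (p := LinearMap.ker (E.coeff x u))).mpr ?_ (coPath_word_mem hE h v)
  rintro _ ⟨w, hw, rfl⟩
  refine coeff_path_of_ne fun heq => hne ?_
  obtain ⟨rfl, rfl⟩ := Prod.mk.inj heq
  exact ⟨rfl, hw⟩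

variable {hE}

lemma strip_mon {i : J} {v : List J} (hv : i ∉ v) :
    E.strip i ((coPathRealization hE).mon v) = 0 := by
  induction v with
  | nil => exact strip_nil i 1
  | cons j v ih =>
    rw [List.mem_cons, not_or] at hv
    rw [Realization.mon_cons, coPathRealization_X, strip_arrow_mul_of_ne (Ne.symm hv.1), ih hv.2,
      mul_zero]

/-- All paths occurring in a monomial start at the vertex `1`, where `χ_i` equals `1`. -/
lemma tw_mon (i : J) (v : List J) :
    E.tw i ((coPathRealization hE).mon v) = (coPathRealization hE).mon v := by
  induction v with
  | nil => exact (tw_path i 1 []).trans (by simp; rfl)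
  | cons j v ih => rw [Realization.mon_cons, tw_mul, ih, coPathRealization_X, tw_path]; simp

/-- The q-analogue of differentiating a power. Moving `X i` past the factor `g i` produced by the
Leibniz rule costs `q = χ_i(g_i)`, so the q-integers satisfy `(n + 2)_q = 1 + q (n + 1)_q`. -/
lemma strip_pow_mul {i : J} (n : ℕ) {w : List J} (hw : i ∉ w) :
    E.strip i ((coPathRealization hE).mon (List.replicate (n + 1) i ++ w)) =
      (∑ l ∈ Finset.range (n + 1), E.q i i ^ l) •
        (coPathRealization hE).word (E.g i) (List.replicate n i ++ w) := by
  induction n with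
  | zero =>
    simp only [zero_add, List.replicate_one, List.replicate_zero, List.nil_append,
      List.singleton_append, Finset.sum_range_one, pow_zero, one_smul, Realization.mon_cons]
    rw [coPathRealization_X, strip_arrow_mul, strip_mon hw, tw_mon, mul_zero, add_zero]
    rfl
  | succ n ih =>
    rw [List.replicate_succ, List.cons_append, Realization.mon_cons, coPathRealization_X,
      strip_arrow_mul, ih, tw_mon, ← coPathRealization_X hE i, mul_smul_comm,
      Realization.X_mul_word, smul_smul, ← List.cons_append, ← List.replicate_succ,
      Finset.sum_range_succ' _ (n + 1), add_smul, add_comm, pow_zero, one_smul]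
    congr 2
    simp only [pow_succ, ← Finset.sum_mul]
    rfl

lemma word_eq_zero_iff (h : G) (v : List J) : (coPathRealization hE).word h v = 0 ↔
    (coPathRealization hE).mon v = 0 := by
  refine ⟨fun H => ?_, fun H => by rw [Realization.word, H, mul_zero]⟩
  have := congrArg ((coPathRealization hE).ι h⁻¹ * ·) H
  simpa [Realization.word, ← mul_assoc, ← map_mul] using this

/-- For `q = 1` the sum is the integer `n + 1`, nonzero in characteristic zero. Otherwise its
vanishing gives `q^(n+1) = 1`, so `q` is a nontrivial root of unity whose order `N i` divides `n +
1`. -/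
lemma geom_sum_q_ne_zero (hk : ∀ i, E.χ i (E.g i) = 1 → CharZero k) {i : J} {n : ℕ}
    (hn : ((n + 1 : ℕ) : ℕ∞) < E.N i) : ∑ l ∈ Finset.range (n + 1), E.q i i ^ l ≠ 0 := by
  by_cases hq : E.q i i = 1
  · have := hk i (Units.val_injective (by simpa [q] using hq))
    simp only [hq, one_pow, Finset.sum_const, Finset.card_range, nsmul_eq_mul, mul_one]
    exact Nat.cast_ne_zero.mpr (Nat.succ_ne_zero n)
  · intro h
    have h1 := geom_sum_mul (E.q i i) (n + 1)
    rw [h, zero_mul] at h1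
    have h2 := orderOf_dvd_of_pow_eq_one (sub_eq_zero.mp h1.symm)
    have h3 := Nat.le_of_dvd (Nat.succ_pos n) h2
    have h4 : orderOf (E.q i i) ≠ 1 := fun h => hq (orderOf_eq_one_iff.mp h)
    have h5 : orderOf (E.q i i) ≠ 0 := fun h => by rw [h] at h2; simp at h2
    rw [N, if_pos (by omega)] at hn
    have : n + 1 < orderOf (E.q i i) := by exact_mod_cast hn
    omega

/-- The power has no vertex coefficients, and its only possible nonzero strip carries the q-integer
of `N i`, which is zero. -/
lemma coPath_pow_eq_zero {i : J} {n : ℕ} (hn : (n : ℕ∞) = E.N i) :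
    (coPathRealization hE).X i ^ n = 0 := by
  rw [N] at hn
  split_ifs at hn with h
  · obtain rfl : n = orderOf (E.q i i) := by exact_mod_cast hn
    obtain ⟨m, hm⟩ := Nat.exists_eq_succ_of_ne_zero (by omega : orderOf (E.q i i) ≠ 0)
    rw [← Realization.mon_replicate]
    refine eq_zero_of_strip (fun x => ?_) fun j => ?_
    · have := coeff_coPath_word hE (x := x) (h := 1) (u := [])
        (v := List.replicate (orderOf (E.q i i)) i) (by simp [hm])
      simpa [Realization.word] using this
    · by_cases hj : j = i
      · subst hj
        have h1 := strip_pow_mul (hE := hE) (i := j) m (w := []) (by simp)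
        -- The sum times `q - 1` is `q^N - 1 = 0`, and `q ≠ 1` because the order exceeds `1`.
        have h2 := geom_sum_mul (E.q j j) (m + 1)
        rw [← Nat.succ_eq_add_one, ← hm, pow_orderOf_eq_one, sub_self, mul_eq_zero] at h2
        rw [← Nat.succ_eq_add_one, ← hm, List.append_nil, List.append_nil,
          h2.resolve_right fun h0 => ?_, zero_smul] at h1
        · exact h1
        · rw [sub_eq_zero.mp h0, orderOf_one] at h; omega
      · exact strip_mon fun h => hj (List.eq_of_mem_replicate h)
  · exact absurd hn (by simp)

/-- Gather all factors `X i` at the front and strip one of them. The q-integer that appears is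
nonzero because the word is reduced, and a shorter reduced monomial remains. -/
lemma coPath_mon_ne_zero [DecidableEq J] (hk : ∀ i, E.χ i (E.g i) = 1 → CharZero k) {v : List J}
    (hv : (v : Multiset J) ∈ Realization.Reduced E) : (coPathRealization hE).mon v ≠ 0 := by
  obtain ⟨n, hn⟩ : ∃ n, v.length = n := ⟨_, rfl⟩
  induction n generalizing v with
  | zero =>
    obtain rfl := List.length_eq_zero_iff.mp hn
    intro h
    have h1 := coeff_path_self (E := E) 1 []
    rw [show E.path 1 [] = 0 from h, map_zero] at h1
    exact zero_ne_one h1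
  | succ n ih =>
    obtain ⟨i, v, rfl⟩ := List.exists_cons_of_length_eq_add_one hn
    have hp : (i :: v).Perm
        (List.replicate (v.count i + 1) i ++ v.filter fun j => !decide (j = i)) := by
      have h1 := List.filter_append_perm (fun j => decide (j = i)) v
      rw [show v.filter (fun j => decide (j = i)) = List.replicate (v.count i) i from
        List.filter_eq i] at h1
      exact (List.perm_cons i).mpr h1.symm
    set w := v.filter fun j => !decide (j = i) with hw
    have hiw : i ∉ w := by simp [hw]
    obtain ⟨c, hc⟩ := (coPathRealization hE).mon_perm hp
    intro h0
    rw [hc, smul_eq_zero_iff_eq] at h0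
    have h1 := strip_pow_mul (hE := hE) (v.count i) hiw
    rw [h0, map_zero] at h1
    have hi := hv i
    rw [Multiset.coe_count, List.count_cons_self] at hi
    have h2 := (smul_eq_zero.mp h1.symm).resolve_left (geom_sum_q_ne_zero hk hi)
    rw [word_eq_zero_iff] at h2
    -- The labels of the remaining monomial form a submultiset of the original ones, so it is still
    -- reduced.
    refine ih (fun j => lt_of_le_of_lt ?_ (hv j)) ?_ h2
    · rw [Multiset.coe_eq_coe.mpr hp, List.replicate_succ]
      simp only [Nat.cast_le]
      exact Multiset.count_le_of_le j (Multiset.le_cons_self _ _)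
    · have := hp.length_eq
      simp at this hn ⊢
      omega

/-- The images in the co-path Hopf algebra of the reduced words are linearly independent. -/
lemma coPath_linearIndependent [DecidableEq J] (hk : ∀ i, E.χ i (E.g i) = 1 → CharZero k) :
    LinearIndependent k fun p : G × Realization.Reduced E =>
      (coPathRealization hE).word p.1 (p.2 : Multiset J).toList := by
  rw [linearIndependent_iff']
  rintro s c hs ⟨h, m, hm⟩ hp
  have hne : (coPathRealization hE).word h m.toList ≠ 0 := by
    rw [Ne, word_eq_zero_iff]
    exact coPath_mon_ne_zero hk (by rwa [Multiset.coe_toList])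
  -- A path occurring in this word occurs in no other word of the family, so its coefficient
  -- isolates a single term of the relation.
  obtain ⟨x, u, hu⟩ : ∃ x u, E.coeff x u ((coPathRealization hE).word h m.toList) ≠ 0 := by
    by_contra! H
    exact hne (ext_coeff fun x u => by rw [H, map_zero])
  have h1 := congrArg (E.coeff x u) hs
  rw [map_sum, map_zero, Finset.sum_eq_single (h, ⟨m, hm⟩)] at h1
  · rw [map_smul, smul_eq_mul] at h1
    exact (mul_eq_zero.mp h1).resolve_right hu
  · rintro ⟨h', m', hm'⟩ _ hne'
    rw [map_smul, coeff_coPath_word, smul_zero]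
    rintro ⟨rfl, h2⟩
    refine hu (coeff_coPath_word hE ?_)
    rintro ⟨rfl, h3⟩
    refine hne' ?_
    have h4 := Multiset.coe_eq_coe.mpr (h2.symm.trans h3)
    rw [Multiset.coe_toList, Multiset.coe_toList] at h4
    subst h4
    rfl
  · exact fun h => absurd hp h

open Classical in
variable (E) in
/-- The projection to the span of the paths of length `n`. -/
noncomputable def lengthProj (n : ℕ) : E.CoPath →ₗ[k] E.CoPath :=
  E.lin fun x v => if v.length = n then E.path x v else 0

lemma lengthProj_of_mem {m n : ℕ} {a : E.CoPath}
    (ha : a ∈ Submodule.span k {a : E.CoPath | ∃ x v, v.length = m ∧ a = E.path x v}) :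
    E.lengthProj n a = if m = n then a else 0 := by
  induction ha using Submodule.span_induction with
  | mem a ha => obtain ⟨x, v, rfl, rfl⟩ := ha; simp [lengthProj]
  | zero => simp
  | add a b _ _ ha hb => rw [map_add, ha, hb]; split_ifs <;> simp
  | smul c a _ ha => rw [map_smul, ha]; split_ifs <;> simp

lemma coPath_word_mem_length (h : G) (v : List J) : (coPathRealization hE).word h v ∈
    Submodule.span k {a : E.CoPath | ∃ x u, u.length = v.length ∧ a = E.path x u} := by
  refine Submodule.span_mono ?_ (coPath_word_mem hE h v)
  rintro _ ⟨u, hu, rfl⟩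
  exact ⟨h, u, List.Perm.length_eq hu, rfl⟩

end CoPathWords
end ESC

namespace ESC

/-! ### The presented algebra: Hopf structure and grading. -/

section Presented
variable {k G J : Type*} [Field k] [Group G]

/-- The algebra with generators `G` and `X i` and defining relations `Rel`. -/
def Presented (E : ESC k G J) : Type _ := RingQuot E.Rel

noncomputable instance (E : ESC k G J) : Ring E.Presented := inferInstanceAs (Ring (RingQuot E.Rel))

noncomputable instance (E : ESC k G J) : Algebra k E.Presented :=
  inferInstanceAs (Algebra k (RingQuot E.Rel))

/-- The identification with the quotient of the free algebra. -/
noncomputable def Presented.equiv (E : ESC k G J) : RingQuot E.Rel ≃ₐ[k] E.Presented :=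
  AlgEquiv.refl

/-- The projection from the free algebra. -/
noncomputable def Presented.mk (E : ESC k G J) : FreeAlgebra k (G ⊕ J) →ₐ[k] E.Presented :=
  (Presented.equiv E).toAlgHom.comp (RingQuot.mkAlgHom k E.Rel)

lemma Presented.mk_rel {E : ESC k G J} {a b : FreeAlgebra k (G ⊕ J)} (h : E.Rel a b) :
    Presented.mk E a = Presented.mk E b :=
  congrArg (Presented.equiv E) (RingQuot.mkAlgHom_rel k h)

lemma Presented.mk_surjective (E : ESC k G J) : Function.Surjective (Presented.mk E) :=
  (Presented.equiv E).surjective.comp (RingQuot.mkAlgHom_surjective k E.Rel)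

namespace Realization
variable {E : ESC k G J} {B : Type*} [Ring B] [Algebra k B]

/-- The homomorphism from the algebra with defining relations `Rel` given by a realization. -/
noncomputable def lift (R : E.Realization B) : E.Presented →ₐ[k] B :=
  (RingQuot.liftAlgHom k ⟨FreeAlgebra.lift k (Sum.elim R.ι R.X), fun {_ _} h => by
    induction h with
    | one => simp
    | mul h h' => simp
    | X_mul_group j h => simpa using R.X_mul_ι j h
    | X_mul_X i j hij => simpa using R.X_mul_X i j hij⟩).comp
    (Presented.equiv E).symm.toAlgHom

variable (E) in
/-- The generators of the algebra with defining relations `Rel`. -/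
noncomputable def presented : E.Realization (E.Presented) where
  ι :=
    { toFun := fun h => Presented.mk E (FreeAlgebra.ι k (Sum.inl h))
      map_one' := (Presented.mk_rel Rel.one).trans (map_one _)
      map_mul' := fun h h' => (Presented.mk_rel (Rel.mul h h')).trans (map_mul _ _ _) }
  X i := Presented.mk E (FreeAlgebra.ι k (Sum.inr i))
  X_mul_ι j h := by
    have := Presented.mk_rel (Rel.X_mul_group (E := E) j h)
    rwa [map_mul, map_smul, map_mul] at this
  X_mul_X i j hij := by
    have := Presented.mk_rel (Rel.X_mul_X (E := E) i j hij)
    rwa [map_mul, map_smul, map_mul] at this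

@[simp] lemma lift_ι (R : E.Realization B) (h : G) : R.lift ((presented E).ι h) = R.ι h := by
  simp [lift, presented, Presented.mk]

@[simp] lemma lift_X (R : E.Realization B) (i : J) : R.lift ((presented E).X i) = R.X i := by
  simp [lift, presented, Presented.mk]

variable (E) in
lemma generates_presented : (presented E).Generates := by
  have h := AlgHom.map_adjoin (Presented.mk E) (Set.range (FreeAlgebra.ι k))
  rw [FreeAlgebra.adjoin_range_ι, Algebra.map_top,
    (AlgHom.range_eq_top _).mpr (Presented.mk_surjective E), ← Set.range_comp] at h
  rw [Generates, h]
  congr 1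
  exact (Set.Sum.elim_range _ _).symm.trans (congrArg Set.range (by ext (_ | _) <;> rfl))

variable (E) in
/-- The counit of the presented algebra, on generators. -/
def counitRealization : E.Realization k where
  ι := 1
  X _ := 0
  X_mul_ι _ _ := by simp
  X_mul_X _ _ _ := by simp

@[simp] lemma counitRealization_ι (h : G) : (counitRealization E).ι h = 1 := rfl
@[simp] lemma counitRealization_X (i : J) : (counitRealization E).X i = 0 := rfl

lemma ι_mul_comm (R : E.Realization B) (i : J) (h : G) :
    R.ι h * R.ι (E.g i) = R.ι (E.g i) * R.ι h := by rw [← map_mul, comm_g, map_mul]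

/-- The comultiplication of the presented algebra, on generators. -/
noncomputable def comulRealization (hE : E.IsQuantumWeaklyCommutative) (R : E.Realization B) :
    E.Realization (B ⊗[k] B) where
  ι :=
    { toFun := fun h => R.ι h ⊗ₜ R.ι h
      map_one' := by simp [Algebra.TensorProduct.one_def]
      map_mul' := by simp }
  X j := R.X j ⊗ₜ 1 + R.ι (E.g j) ⊗ₜ R.X j
  X_mul_ι j h := by
    change _ * (R.ι h ⊗ₜ R.ι h) = _ • ((R.ι h ⊗ₜ R.ι h) * _)
    simp only [add_mul, mul_add, Algebra.TensorProduct.tmul_mul_tmul, R.X_mul_ι, one_mul, mul_one,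
      smul_add, TensorProduct.smul_tmul', TensorProduct.tmul_smul, R.ι_mul_comm j h]
  X_mul_X i j hij := by
    -- Needed for the mixed terms: `g_j X_i ⊗ X_j` has coefficient `1` on the left and `χ_j(g_i)
    -- χ_i(g_j)` on the right.
    have h : (E.χ j (E.g i) : k) * (E.χ i (E.g j) : k) = 1 := by
      rw [← Units.val_mul, hE j i hij.symm, Units.val_one]
    simp only [add_mul, mul_add, Algebra.TensorProduct.tmul_mul_tmul, R.X_mul_ι,
      one_mul, mul_one, smul_add, R.X_mul_X i j hij, ← TensorProduct.smul_tmul',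
      TensorProduct.tmul_smul, smul_smul, h, one_smul]
    rw [R.ι_mul_comm i]
    abel

@[simp] lemma comulRealization_ι (hE : E.IsQuantumWeaklyCommutative) (R : E.Realization B) (h : G) :
    (R.comulRealization hE).ι h = R.ι h ⊗ₜ R.ι h := rfl

@[simp] lemma comulRealization_X (hE : E.IsQuantumWeaklyCommutative) (R : E.Realization B) (i : J) :
    (R.comulRealization hE).X i = R.X i ⊗ₜ 1 + R.ι (E.g i) ⊗ₜ R.X i := rfl

/-- The antipode of the presented algebra, on generators. -/
noncomputable def antipodeRealization (hE : E.IsQuantumWeaklyCommutative) (R : E.Realization B) :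
    E.Realization Bᵐᵒᵖ where
  ι :=
    { toFun := fun h => MulOpposite.op (R.ι h⁻¹)
      map_one' := by simp
      map_mul' := by simp }
  X j := MulOpposite.op (-(R.ι (E.g j)⁻¹ * R.X j))
  X_mul_ι j h := by
    refine MulOpposite.unop_injective ?_
    have h1 : R.ι h⁻¹ * R.ι (E.g j)⁻¹ = R.ι (E.g j)⁻¹ * R.ι h⁻¹ := by
      rw [← map_mul, comm_g', map_mul]
    simp only [MonoidHom.coe_mk, OneHom.coe_mk, MulOpposite.unop_mul, MulOpposite.unop_op,
      MulOpposite.unop_smul, mul_neg, neg_mul, smul_neg, mul_assoc, R.X_mul_ι, mul_smul_comm,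
      smul_smul, ← Units.val_mul, ← map_mul, mul_inv_cancel, map_one, Units.val_one, one_smul]
    rw [← mul_assoc, h1, mul_assoc]
  X_mul_X i j hij := by
    refine MulOpposite.unop_injective ?_
    have h1 : R.ι (E.g i)⁻¹ * R.ι (E.g j)⁻¹ = R.ι (E.g j)⁻¹ * R.ι (E.g i)⁻¹ := by
      rw [← map_mul, comm_g', map_mul]
    have h2 : ∀ i j, R.ι (E.g i)⁻¹ * R.X i * (R.ι (E.g j)⁻¹ * R.X j) =
        (E.χ i (E.g j)⁻¹ : k) • (R.ι (E.g i)⁻¹ * R.ι (E.g j)⁻¹ * (R.X i * R.X j)) := fun i j => by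
      rw [mul_assoc, ← mul_assoc (R.X i), R.X_mul_ι, smul_mul_assoc, mul_smul_comm]
      simp only [mul_assoc]
    have h3 : (E.χ i (E.g j)⁻¹ : k) = (E.χ j (E.g i) : k) := by
      rw [map_inv, ← eq_inv_of_mul_eq_one_right (hE i j hij)]
    simp only [MulOpposite.unop_mul, MulOpposite.unop_op, MulOpposite.unop_smul, neg_mul_neg]
    rw [h2, h2, h1, R.X_mul_X i j hij, mul_smul_comm, smul_smul, smul_smul, h3, ← Units.val_mul,
      ← Units.val_mul, map_inv (E.χ j), mul_inv_cancel, one_mul]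

end Realization

open Realization

variable (E : ESC k G J) (hE : E.IsQuantumWeaklyCommutative)

/-- The bialgebra structure of the presented algebra. -/
noncomputable abbrev presentedBialgebra : Bialgebra k (E.Presented) :=
  Bialgebra.ofAlgHom ((presented E).comulRealization hE).lift (counitRealization E).lift
    ((generates_presented E).algHom_ext (fun h => by simp) (fun i => by
      simp [TensorProduct.add_tmul, TensorProduct.tmul_add, add_assoc,
        Algebra.TensorProduct.one_def]))
    ((generates_presented E).algHom_ext (fun h => by simp) (fun i => by simp))
    ((generates_presented E).algHom_ext (fun h => by simp) (fun i => by simp))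

/-- The antipode of the presented algebra. -/
noncomputable def presentedAntipode : E.Presented →ₗ[k] E.Presented :=
  (MulOpposite.opLinearEquiv k).symm.toLinearMap ∘ₗ
    ((presented E).antipodeRealization hE).lift.toLinearMap

variable {E}

lemma presentedAntipode_mul (a b : E.Presented) : E.presentedAntipode hE (a * b) =
    E.presentedAntipode hE b * E.presentedAntipode hE a := by
  simp [presentedAntipode]

lemma presentedAntipode_ι (h : G) :
    E.presentedAntipode hE ((presented E).ι h) = (presented E).ι h⁻¹ := by
  simp [presentedAntipode, antipodeRealization]

lemma presentedAntipode_X (i : J) : E.presentedAntipode hE ((presented E).X i) =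
    -((presented E).ι (E.g i)⁻¹ * (presented E).X i) := by
  simp [presentedAntipode, antipodeRealization]

lemma presentedAntipode_one : E.presentedAntipode hE 1 = 1 := by
  simp [presentedAntipode]

/-- Let `m` denote multiplication. Applied to `Δ(x) t` for a generator `x`, the map `m (S ⊗ id)`
returns its value at `t` if `x = h`, and `0` if `x = X i`. So the identity propagates under left
multiplication by generators. -/
lemma mul_presentedAntipode_rTensor (a : E.Presented) :
    LinearMap.mul' k _ ((E.presentedAntipode hE).rTensor _
      (((presented E).comulRealization hE).lift a)) =
    algebraMap k _ ((counitRealization E).lift a) := by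
  refine (generates_presented E).induction (p := fun a => LinearMap.mul' k _
    ((E.presentedAntipode hE).rTensor _ (((presented E).comulRealization hE).lift a)) =
      algebraMap k _ ((counitRealization E).lift a)) ?_ (fun h a ih => ?_) (fun i a ih => ?_)
    (fun a b ha hb => ?_) (fun c a ha => ?_) a
  · simp [Algebra.TensorProduct.one_def, presentedAntipode_one]
  · rw [map_mul ((presented E).comulRealization hE).lift, map_mul (counitRealization E).lift, lift_ι, lift_ι]
    have : ∀ t, LinearMap.mul' k _ ((E.presentedAntipode hE).rTensor _
        (((presented E).comulRealization hE).ι h * t)) =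
        LinearMap.mul' k _ ((E.presentedAntipode hE).rTensor _ t) := by
      intro t
      induction t with
      | zero => simp
      | add a b ha hb => simp only [mul_add, map_add, ha, hb]
      | tmul a b =>
        simp only [comulRealization_ι,
          Algebra.TensorProduct.tmul_mul_tmul, LinearMap.rTensor_tmul, LinearMap.mul'_apply,
          presentedAntipode_mul, presentedAntipode_ι]
        rw [mul_assoc, ← mul_assoc ((presented E).ι h⁻¹), ← map_mul, inv_mul_cancel, map_one,
          one_mul]
    rw [this, ih]
    simp
  · rw [map_mul ((presented E).comulRealization hE).lift, map_mul (counitRealization E).lift, lift_X, lift_X]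
    have : ∀ t, LinearMap.mul' k _ ((E.presentedAntipode hE).rTensor _
        (((presented E).comulRealization hE).X i * t)) = 0 := by
      intro t
      induction t with
      | zero => simp
      | add a b ha hb => simp only [mul_add, map_add, ha, hb, add_zero]
      | tmul a b =>
        simp only [comulRealization_X, add_mul, map_add, one_mul,
          Algebra.TensorProduct.tmul_mul_tmul, LinearMap.rTensor_tmul, LinearMap.mul'_apply,
          presentedAntipode_mul, presentedAntipode_ι, presentedAntipode_X]
        simp [mul_assoc]
    rw [this]
    simp
  · simp only [map_add, ha, hb]
  · simp only [map_smul, ha, Algebra.algebraMap_eq_smul_one, smul_eq_mul, mul_smul]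

/-- With `S` on the right factor, the generators wrap around the previous value. By induction that
value is a scalar, hence central, so `h` cancels with `h⁻¹` and the two terms from `X i` cancel each
other. -/
lemma mul_presentedAntipode_lTensor (a : E.Presented) :
    LinearMap.mul' k _ ((E.presentedAntipode hE).lTensor _
      (((presented E).comulRealization hE).lift a)) =
    algebraMap k _ ((counitRealization E).lift a) := by
  refine (generates_presented E).induction (p := fun a => LinearMap.mul' k _
    ((E.presentedAntipode hE).lTensor _ (((presented E).comulRealization hE).lift a)) =
      algebraMap k _ ((counitRealization E).lift a)) ?_ (fun h a ih => ?_) (fun i a ih => ?_)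
    (fun a b ha hb => ?_) (fun c a ha => ?_) a
  · simp [Algebra.TensorProduct.one_def, presentedAntipode_one]
  · rw [map_mul ((presented E).comulRealization hE).lift, map_mul (counitRealization E).lift, lift_ι, lift_ι]
    have : ∀ t, LinearMap.mul' k _ ((E.presentedAntipode hE).lTensor _
        (((presented E).comulRealization hE).ι h * t)) =
        (presented E).ι h * LinearMap.mul' k _ ((E.presentedAntipode hE).lTensor _ t) *
          (presented E).ι h⁻¹ := by
      intro t
      induction t with
      | zero => simp
      | add a b ha hb => simp only [mul_add, map_add, ha, hb, add_mul]
      | tmul a b =>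
        simp only [comulRealization_ι,
          Algebra.TensorProduct.tmul_mul_tmul, LinearMap.lTensor_tmul, LinearMap.mul'_apply,
          presentedAntipode_mul, presentedAntipode_ι, mul_assoc]
    rw [this, ih, ← Algebra.commutes, mul_assoc, ← map_mul]
    simp
  · rw [map_mul ((presented E).comulRealization hE).lift, map_mul (counitRealization E).lift, lift_X, lift_X]
    have : ∀ t, LinearMap.mul' k _ ((E.presentedAntipode hE).lTensor _
        (((presented E).comulRealization hE).X i * t)) =
        (presented E).X i * LinearMap.mul' k _ ((E.presentedAntipode hE).lTensor _ t) -
        (presented E).ι (E.g i) * LinearMap.mul' k _ ((E.presentedAntipode hE).lTensor _ t) *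
          ((presented E).ι (E.g i)⁻¹ * (presented E).X i) := by
      intro t
      induction t with
      | zero => simp
      | add a b ha hb => simp only [mul_add, map_add, ha, hb, add_mul]; abel
      | tmul a b =>
        simp only [comulRealization_X, add_mul, map_add, one_mul,
          Algebra.TensorProduct.tmul_mul_tmul, LinearMap.lTensor_tmul, LinearMap.mul'_apply,
          presentedAntipode_mul, presentedAntipode_X]
        simp only [mul_assoc, mul_neg, sub_eq_add_neg]
    rw [this, ih, ← Algebra.commutes, ← Algebra.commutes, mul_assoc, ← mul_assoc (ι _ _),
      ← map_mul]
    simp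
  · simp only [map_add, ha, hb]
  · simp only [map_smul, ha, Algebra.algebraMap_eq_smul_one, smul_eq_mul, mul_smul]

variable (E) in
/-- The Hopf algebra structure of the presented algebra. -/
noncomputable abbrev presentedHopfAlgebra : HopfAlgebra k (E.Presented) :=
  { E.presentedBialgebra hE with
    antipode := E.presentedAntipode hE
    mul_antipode_rTensor_comul := LinearMap.ext (mul_presentedAntipode_rTensor hE)
    mul_antipode_lTensor_comul := LinearMap.ext (mul_presentedAntipode_lTensor hE) }

lemma isHopf_presented : @IsHopf _ _ _ _ _ E _ _ (E.presentedHopfAlgebra hE) (presented E) :=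
  letI := E.presentedHopfAlgebra hE
  { isGroupLikeElem_ι := fun h =>
      { counit_eq_one := lift_ι (counitRealization E) h
        comul_eq_tmul_self := lift_ι ((presented E).comulRealization hE) h }
    comul_X := fun j => lift_X ((presented E).comulRealization hE) j }

/-- The `X i`, multiplied by a polynomial variable. -/
noncomputable def Realization.polynomial {B : Type*} [Ring B] [Algebra k B] (R : E.Realization B) :
    E.Realization (Polynomial B) where
  ι := (Polynomial.C : B →+* Polynomial B).toMonoidHom.comp R.ι
  X i := Polynomial.monomial 1 (R.X i)
  X_mul_ι j h := by
    simp [← Polynomial.monomial_zero_left, Polynomial.monomial_mul_monomial, R.X_mul_ι]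
  X_mul_X i j hij := by
    simp [Polynomial.monomial_mul_monomial, R.X_mul_X i j hij]

lemma Realization.polynomial_word {B : Type*} [Ring B] [Algebra k B] (R : E.Realization B) (h : G)
    (v : List J) : R.polynomial.word h v = Polynomial.monomial v.length (R.word h v) := by
  have h1 : R.polynomial.mon v = Polynomial.monomial v.length (R.mon v) := by
    induction v with
    | nil => simp
    | cons i v ih =>
      rw [mon_cons, ih, mon_cons, List.length_cons, add_comm]
      exact Polynomial.monomial_mul_monomial _ _ _ _
  rw [word, h1]
  change Polynomial.monomial 0 (R.ι h) * _ = _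
  rw [Polynomial.monomial_mul_monomial, zero_add]
  rfl

lemma Realization.map_lift {B : Type*} [Ring B] [Algebra k B] (R : E.Realization B) :
    (presented E).map R.lift = R :=
  Realization.ext (MonoidHom.ext R.lift_ι) (funext R.lift_X)

lemma Realization.lift_word {B : Type*} [Ring B] [Algebra k B] (R : E.Realization B) (h : G)
    (v : List J) : R.lift ((presented E).word h v) = R.word h v := by
  rw [← map_word, map_lift]

variable (E) in
-- The relations are homogeneous, so `h ↦ h`, `X_i ↦ X_i t` defines a homomorphism to the polynomial
-- ring. Its coefficient at `t^n` is the projection to degree `n`.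
lemma isInternal_presented : DirectSum.IsInternal (presented E).deg := by
  have key : ∀ m n, ∀ a ∈ (presented E).deg m,
      Polynomial.lcoeff (E.Presented) n ((presented E).polynomial.lift a) =
        if m = n then a else 0 := by
    intro m n a ha
    induction ha using Submodule.span_induction with
    | mem a ha =>
      obtain ⟨h, v, rfl, rfl⟩ := ha
      rw [lift_word, polynomial_word, Polynomial.lcoeff_apply, Polynomial.coeff_monomial]
    | zero => simp
    | add a b _ _ ha hb => rw [map_add, map_add, ha, hb]; split_ifs <;> simp
    | smul c a _ ha =>
      rw [map_smul, Polynomial.lcoeff_apply, Polynomial.coeff_smul, ← Polynomial.lcoeff_apply, ha]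
      split_ifs <;> simp
  refine (generates_presented E).isInternal_deg
    (fun n => ((Polynomial.lcoeff (E.Presented) n).restrictScalars k) ∘ₗ
      (presented E).polynomial.lift.toLinearMap) (fun n h v hn => ?_) (fun n a ha h => ?_)
  · exact (key _ n _ ((presented E).word_mem_deg h v)).trans (if_neg hn)
  · exact (if_pos rfl).symm.trans ((key n n a ha).symm.trans h)

end Presented

/-! ### Independence conditions pulled back from the path basis. -/

section SystemOfRealization
variable {k G J : Type*} [Field k] [Group G] {E : ESC k G J}

lemma linearIndependent_path :
    LinearIndependent k fun p : G × List J => E.path p.1 p.2 := by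
  rw [linearIndependent_iff']
  intro s c hs p hp
  have h := congrArg (E.coeff p.1 p.2) hs
  rw [map_sum, map_zero, Finset.sum_eq_single p (fun q _ hq => ?_) (fun h => absurd hp h), map_smul,
    coeff_path_self, smul_eq_mul, mul_one] at h
  · exact h
  · rw [map_smul, coeff_path_of_ne hq, smul_zero]

/-- A Hopf algebra with a realization which maps to the co-path Hopf algebra satisfies the conditions
of `System`. -/
def Realization.IsHopf.system {A : Type*} [Ring A] [HopfAlgebra k A] {R : E.Realization A}
    (hR : R.IsHopf) (hg : R.Generates) (f : A →ₐ[k] E.CoPath)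
    (hι : ∀ h, f (R.ι h) = E.path h []) (hX : ∀ i, f (R.X i) = E.path 1 [i]) : E.System A where
  ι := R.ι
  X := R.X
  ι_injective h h' hh := by
    have h1 := congrArg f hh
    rw [hι, hι] at h1
    exact (Prod.mk.inj (linearIndependent_path.injective (a₁ := (h, [])) (a₂ := (h', [])) h1)).1
  isGroupLikeElem_ι := hR.isGroupLikeElem_ι
  linearIndependent_X := by
    refine LinearIndependent.of_comp f.toLinearMap ?_
    rw [show f.toLinearMap ∘ R.X = (fun p : G × List J => E.path p.1 p.2) ∘ fun i => (1, [i]) from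
      funext hX]
    exact linearIndependent_path.comp _ fun i j h => by simpa using h
  adjoin_eq_top := hg
  comul_X := hR.comul_X
  X_mul_ι := R.X_mul_ι
  X_mul_X := R.X_mul_X
  disjoint := by
    rw [Submodule.disjoint_def]
    intro a h0 h1
    -- Images of `kG` involve vertices only, while images of the span of the `h X i` involve arrows
    -- only, so an element of both spaces goes to `0`.
    have h2 : ∀ x v, v ≠ [] → E.coeff x v (f a) = 0 := by
      intro x v hv
      refine (Submodule.span_le (p := LinearMap.ker (E.coeff x v ∘ₗ f.toLinearMap))).mpr ?_ h0
      rintro _ ⟨h, rfl⟩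
      change E.coeff x v (f (R.ι h)) = 0
      rw [hι]
      exact coeff_path_of_ne fun h => hv (Prod.mk.inj h).2.symm
    have h3 : ∀ x, E.coeff x [] (f a) = 0 := by
      intro x
      refine (Submodule.span_le (p := LinearMap.ker (E.coeff x [] ∘ₗ f.toLinearMap))).mpr ?_ h1
      rintro _ ⟨p, rfl⟩
      change E.coeff x [] (f (R.ι p.1 * R.X p.2)) = 0
      rw [map_mul, hι, hX, vertex_mul_path]
      exact coeff_path_of_ne (by simp)
    obtain ⟨c, rfl⟩ := Finsupp.mem_span_range_iff_exists_finsupp.mp h0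
    have h4 : f (c.sum fun h r => r • R.ι h) = 0 := ext_coeff fun x v => by
      rw [map_zero]
      by_cases hv : v = []
      · rw [hv, h3]
      · exact h2 x v hv
    -- Distinct elements of `G` go to distinct vertices, so `f` is injective on `kG`.
    have h5 : LinearIndependent k fun h => f (R.ι h) := by
      simp only [hι]
      exact linearIndependent_path.comp (fun h : G => (h, [])) fun h h' hh => by simpa using hh
    have h6 : c = 0 := by
      refine linearIndependent_iff.mp h5 c ?_
      rw [← h4, Finsupp.linearCombination_apply, map_finsuppSum]
      simp only [map_smul]
    rw [h6, Finsupp.sum_zero_index]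

end SystemOfRealization
end ESC

namespace ESC

/-! ### Linear functionals with prescribed values. -/

section ExistsFunctional
variable {k V I : Type*} [Field k] [AddCommGroup V] [Module k V]

/-- A linear functional can be prescribed on a linearly independent family. -/
lemma exists_functional {f : I → V} (hf : LinearIndependent k f) (c : I → k) :
    ∃ l : V →ₗ[k] k, ∀ i, l (f i) = c i := by
  obtain ⟨l, hl⟩ := LinearMap.exists_extend (Finsupp.linearCombination k c ∘ₗ hf.repr)
  refine ⟨l, fun i => ?_⟩
  have h := LinearMap.congr_fun hl ⟨f i, Submodule.subset_span ⟨i, rfl⟩⟩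
  simpa [hf.repr_eq_single i ⟨f i, Submodule.subset_span ⟨i, rfl⟩⟩ rfl] using h

lemma linearIndependent_of_functional {f : I → V}
    (h : ∀ i, ∃ l : V →ₗ[k] k, l (f i) = 1 ∧ ∀ j, j ≠ i → l (f j) = 0) :
    LinearIndependent k f := by
  rw [linearIndependent_iff']
  intro s c hs i hi
  obtain ⟨l, h1, h2⟩ := h i
  have h3 := congrArg l hs
  rw [map_sum, map_zero, Finset.sum_eq_single i
    (fun j _ hj => by rw [map_smul, h2 j hj, smul_zero]) (fun h => absurd hi h), map_smul, h1,
    smul_eq_mul, mul_one] at h3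
  exact h3

/-- A linear functional can be prescribed on a linearly independent family of homogeneous elements of
degree `n` such that it vanishes in all other degrees. -/
lemma exists_homogeneous_functional {𝒜 : ℕ → Submodule k V} (h𝒜 : DirectSum.IsInternal 𝒜)
    {f : I → V} (hf : LinearIndependent k f) {n : ℕ} (hn : ∀ i, f i ∈ 𝒜 n) (c : I → k) :
    ∃ l : V →ₗ[k] k, (∀ i, l (f i) = c i) ∧ ∀ m, m ≠ n → ∀ a ∈ 𝒜 m, l a = 0 := by
  obtain ⟨l, hl⟩ := exists_functional hf c
  let e := LinearEquiv.ofBijective (DirectSum.coeLinearMap 𝒜) h𝒜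
  have he : ∀ m a (ha : a ∈ 𝒜 m), e.symm a = DirectSum.lof k ℕ (fun i => 𝒜 i) m ⟨a, ha⟩ :=
    fun m a ha => by
      rw [LinearEquiv.symm_apply_eq]
      exact (DirectSum.coeLinearMap_lof 𝒜 m ⟨a, ha⟩).symm
  -- Projecting to degree `n` before applying `l` makes the functional vanish in the other degrees
  -- and does not affect the family.
  refine ⟨l ∘ₗ (𝒜 n).subtype ∘ₗ DirectSum.component k ℕ (fun i => 𝒜 i) n ∘ₗ e.symm.toLinearMap,
    fun i => ?_, fun m hm a ha => ?_⟩
  · simp only [LinearMap.comp_apply, LinearEquiv.coe_coe, he n _ (hn i),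
      DirectSum.component.lof_self]
    exact hl i
  · simp only [LinearMap.comp_apply, LinearEquiv.coe_coe, he m a ha]
    rw [DirectSum.component.of, dif_neg hm, map_zero, map_zero]

end ExistsFunctional

/-! ### Contraction of the comultiplication with a functional. -/

section Contract
variable {k A : Type*} [Field k] [Ring A] [HopfAlgebra k A]

/-- The contraction `a ↦ ∑ l(a₂) a₁` of the comultiplication with a linear functional `l`. -/
noncomputable def contract (l : A →ₗ[k] k) : A →ₗ[k] A :=
  (TensorProduct.rid k A).toLinearMap ∘ₗ l.lTensor A ∘ₗ comul

lemma rid_lTensor_mul (l : A →ₗ[k] k) (u w : A) (t : A ⊗[k] A) :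
    TensorProduct.rid k A (l.lTensor A (u ⊗ₜ w * t)) =
      u * TensorProduct.rid k A ((l ∘ₗ LinearMap.mulLeft k w).lTensor A t) := by
  induction t with
  | zero => simp
  | add a b ha hb => simp only [mul_add, map_add, ha, hb]
  | tmul a b => simp

lemma contract_mul_of_isGroupLikeElem (l : A →ₗ[k] k) {u : A} (hu : IsGroupLikeElem k u) (a : A) :
    contract l (u * a) = u * contract (l ∘ₗ LinearMap.mulLeft k u) a := by
  simp only [contract, LinearMap.comp_apply, LinearEquiv.coe_coe, Bialgebra.comul_mul,
    hu.comul_eq_tmul_self, rid_lTensor_mul]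

/-- A skew Leibniz rule matching `strip_arrow_mul`: the right tensor factor of each term of the
coproduct of `X` is absorbed into the functional. -/
lemma contract_mul_of_comul (l : A →ₗ[k] k) {X g : A} (hX : comul (R := k) X = X ⊗ₜ 1 + g ⊗ₜ X)
    (a : A) :
    contract l (X * a) = X * contract l a + g * contract (l ∘ₗ LinearMap.mulLeft k X) a := by
  simp only [contract, LinearMap.comp_apply, LinearEquiv.coe_coe, Bialgebra.comul_mul,
    hX, add_mul, map_add, rid_lTensor_mul, LinearMap.mulLeft_one, LinearMap.comp_id]

lemma contract_one (l : A →ₗ[k] k) : contract l 1 = l 1 • (1 : A) := by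
  simp [contract, Algebra.TensorProduct.one_def]

lemma contract_zero : contract (0 : A →ₗ[k] k) = 0 := by simp [contract]

end Contract

/-! ### The homomorphism from a graded Hopf algebra to the co-path Hopf algebra. -/

section ToCoPath
variable {k G J : Type*} [Field k] [Group G] {E : ESC k G J}

namespace Realization
variable {A : Type*} [Ring A] [HopfAlgebra k A] {R : E.Realization A}

lemma IsHopf.linearIndependent_ι (hR : R.IsHopf) (hι : Function.Injective R.ι) :
    LinearIndependent k R.ι :=
  (linearIndepOn_isGroupLikeElem (R := k) (A := A)).comp
    (fun h : G => (⟨R.ι h, hR.isGroupLikeElem_ι h⟩ : {a : A | IsGroupLikeElem k a}))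
    fun _ _ h => hι (congrArg Subtype.val h)

/-- There is a linear functional with prescribed values on `G` which vanishes on all words of positive
length. -/
lemma IsHopf.exists_functional_zero (hR : R.IsHopf) (hι : Function.Injective R.ι)
    (hint : DirectSum.IsInternal R.deg) (c : G → k) :
    ∃ l : A →ₗ[k] k, (∀ h, l (R.word h []) = c h) ∧ ∀ h v, v ≠ [] → l (R.word h v) = 0 := by
  obtain ⟨l, h1, h2⟩ := exists_homogeneous_functional hint (hR.linearIndependent_ι hι)
    R.ι_mem_deg c
  refine ⟨l, fun h => by simpa [word] using h1 h, fun h v hv => ?_⟩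
  exact h2 v.length (fun h => hv (List.length_eq_zero_iff.mp h)) _ (R.word_mem_deg h v)

/-- Contraction with a functional that is the delta function of `x` on `G` and zero on longer words
keeps `x X_j` and kills `h X_j` for `h ≠ x`. Translating back by `x⁻¹` leaves the independent family
`X`. -/
lemma IsHopf.linearIndependent_word_singleton (hR : R.IsHopf) (hι : Function.Injective R.ι)
    (hX : LinearIndependent k R.X) (hint : DirectSum.IsInternal R.deg) :
    LinearIndependent k fun p : G × J => R.word p.1 [p.2] := by
  classical
  refine linearIndependent_of_functional fun ⟨x, i⟩ => ?_
  obtain ⟨l, h1, h2⟩ := hR.exists_functional_zero hι hint (Pi.single x 1)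
  obtain ⟨m, hm⟩ := exists_functional hX (Pi.single i 1)
  have h3 : ∀ h j, contract l (R.word h [j]) = (Pi.single x 1 : G → k) h • R.word h [j] := by
    intro h j
    have h4 : comul (R := k) (R.word h [j]) =
        R.word h [j] ⊗ₜ R.word h [] + R.word (h * E.g j) [] ⊗ₜ R.word h [j] := by
      simp [word, Bialgebra.comul_mul, (hR.isGroupLikeElem_ι h).comul_eq_tmul_self, hR.comul_X,
        mul_add]
    simp [contract, h4, h1, h2]
  have h5 : ∀ h j, R.ι h⁻¹ * R.word h [j] = R.X j := fun h j => by
    rw [ι_mul_word, inv_mul_cancel]; simp [word]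
  refine ⟨m ∘ₗ LinearMap.mulLeft k (R.ι x⁻¹) ∘ₗ contract l, ?_, ?_⟩
  · simp [h3, h5, hm]
  · rintro ⟨h, j⟩ hne
    by_cases hh : h = x
    · subst hh
      have hj : j ≠ i := fun hj => hne (by rw [hj])
      simp [h3, h5, hm, hj]
    · simp [h3, hh]

/-- There is a linear functional which is `1` on the words `h X i` and vanishes on all other words. -/
lemma IsHopf.exists_functional_one (hR : R.IsHopf) (hι : Function.Injective R.ι)
    (hX : LinearIndependent k R.X) (hint : DirectSum.IsInternal R.deg) (i : J) :
    ∃ l : A →ₗ[k] k, (∀ h, l (R.word h [i]) = 1) ∧ ∀ h v, v ≠ [i] → l (R.word h v) = 0 := by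
  classical
  obtain ⟨l, h1, h2⟩ := exists_homogeneous_functional hint
    (hR.linearIndependent_word_singleton hι hX hint) (fun p => R.word_mem_deg p.1 [p.2])
    (fun p => if p.2 = i then 1 else 0)
  refine ⟨l, fun h => by simpa using h1 (h, i), fun h v hv => ?_⟩
  match v with
  | [] => exact h2 0 (by simp) _ (R.word_mem_deg h [])
  | [j] => simpa [show j ≠ i from fun hj => hv (by rw [hj])] using h1 (h, j)
  | j :: j' :: v => exact h2 (v.length + 2) (by simp) _ (R.word_mem_deg h (j :: j' :: v))

/-- If every linear relation between words in one algebra also holds in another one, then there is a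
homomorphism between these algebras which preserves words. -/
lemma Generates.exists_algHom {B C : Type*} [Ring B] [Algebra k B] [Ring C] [Algebra k C]
    {R : E.Realization B} (hg : R.Generates) (R' : E.Realization C)
    (h : ∀ p ∈ Submodule.span k (Set.range fun p : G × List J => (R.word p.1 p.2, R'.word p.1 p.2)),
      p.1 = 0 → p.2 = 0) :
    ∃ f : B →ₐ[k] C, ∀ h v, f (R.word h v) = R'.word h v := by
  let π := Finsupp.linearCombination k fun p : G × List J => R.word p.1 p.2
  let φ := Finsupp.linearCombination k fun p : G × List J => R'.word p.1 p.2
  have hπ : Function.Surjective π := by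
    rw [← LinearMap.range_eq_top, Finsupp.range_linearCombination, hg.span_word]
  -- The span of the pairs of words consists of the pairs `(π c, φ c)`, so the hypothesis is
  -- precisely this inclusion.
  have hker : LinearMap.ker π ≤ LinearMap.ker φ := by
    intro c hc
    refine h (π c, φ c) ?_ hc
    refine Finsupp.mem_span_range_iff_exists_finsupp.mpr ⟨c, ?_⟩
    refine Prod.ext ?_ ?_
    · simp [Finsupp.sum, π, Finsupp.linearCombination_apply, Prod.fst_sum]
    · simp [Finsupp.sum, φ, Finsupp.linearCombination_apply, Prod.snd_sum]
  let f : B →ₗ[k] C := (LinearMap.ker π).liftQ φ hker ∘ₗ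
    (π.quotKerEquivOfSurjective hπ).symm.toLinearMap
  have hf : ∀ h v, f (R.word h v) = R'.word h v := by
    intro h v
    have h1 : R.word h v = π (Finsupp.single (h, v) 1) := by simp [π]
    have h2 : R'.word h v = φ (Finsupp.single (h, v) 1) := by simp [φ]
    have h3 : (π.quotKerEquivOfSurjective hπ).symm (π (Finsupp.single (h, v) 1)) =
        (LinearMap.ker π).mkQ (Finsupp.single (h, v) 1) := by
      rw [LinearEquiv.symm_apply_eq]; rfl
    rw [h2, h1, LinearMap.comp_apply, LinearEquiv.coe_coe, h3, Submodule.mkQ_apply,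
      Submodule.liftQ_apply]
  have hmul : (LinearMap.mul k B).compr₂ f = (LinearMap.mul k C).compl₁₂ f f := by
    refine LinearMap.ext_on_range hg.span_word fun p => ?_
    refine LinearMap.ext_on_range hg.span_word fun p' => ?_
    simp [word_mul_word, hf]
  refine ⟨AlgHom.ofLinearMap f ?_ fun a b => LinearMap.congr_fun₂ hmul a b, hf⟩
  simpa [word] using hf 1 []

/-- A graded Hopf algebra generated by group-like elements `ι h` and skew-primitive elements `X i`, both
linearly independent, maps to the co-path Hopf algebra. -/
theorem IsHopf.exists_algHom_coPath (hR : R.IsHopf) (hg : R.Generates)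
    (hι : Function.Injective R.ι) (hX : LinearIndependent k R.X)
    (hint : DirectSum.IsInternal R.deg) (hE : E.IsQuantumWeaklyCommutative) :
    ∃ f : A →ₐ[k] E.CoPath, ∀ h v, f (R.word h v) = (coPathRealization hE).word h v := by
  classical
  set R' := coPathRealization hE with hR'
  -- On words, `ρ x` plays the role of the coefficient at the vertex `x`, and contraction with `τ i`
  -- and `l i` plays the role of `tw i` and `strip i`.
  choose ρ hρ hρ' using fun x => hR.exists_functional_zero hι hint (Pi.single x 1)
  choose τ hτ hτ' using fun i => hR.exists_functional_zero hι hint fun h => (E.χ i h : k)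
  choose l hl hl' using hR.exists_functional_one hι hX hint
  have hτX : ∀ i j, τ i ∘ₗ LinearMap.mulLeft k (R.X j) = 0 := fun i j => by
    refine LinearMap.ext_on_range hg.span_word fun ⟨h', v⟩ => ?_
    simp [X_mul_word, hτ']
  have hlι : ∀ i h, l i ∘ₗ LinearMap.mulLeft k (R.ι h) = l i := fun i h => by
    refine LinearMap.ext_on_range hg.span_word fun ⟨h', v⟩ => ?_
    by_cases hv : v = [i] <;> simp [ι_mul_word, hv, hl, hl']
  have hlX : ∀ i, l i ∘ₗ LinearMap.mulLeft k (R.X i) = τ i := fun i => by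
    refine LinearMap.ext_on_range hg.span_word fun ⟨h', v⟩ => ?_
    by_cases hv : v = [] <;> simp [X_mul_word, hv, hl, hl', hτ, hτ']
  have hlX' : ∀ i j, j ≠ i → l i ∘ₗ LinearMap.mulLeft k (R.X j) = 0 := fun i j hj => by
    refine LinearMap.ext_on_range hg.span_word fun ⟨h', v⟩ => ?_
    simp [X_mul_word, hl', hj]
  have hτmon : ∀ i v, contract (τ i) (R.mon v) = R.mon v := by
    intro i v
    induction v with
    | nil => simpa [contract_one, word] using congrArg (· • (1 : A)) (hτ i 1)
    | cons j v ih =>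
      rw [mon_cons, contract_mul_of_comul _ (hR.comul_X j), hτX, ih, contract_zero]; simp
  -- `W` is the relation "same combination of words" between the two algebras. The goal is that it
  -- is single-valued from left to right.
  let W := Submodule.span k
    (Set.range fun p : G × List J => (R.word p.1 p.2, R'.word p.1 p.2))
  have hWι : ∀ h, ∀ p ∈ W, (R.ι h * p.1, R'.ι h * p.2) ∈ W := by
    intro h p hp
    refine (Submodule.map_span_le ((LinearMap.mulLeft k (R.ι h)).prodMap
      (LinearMap.mulLeft k (R'.ι h))) _ W).mpr ?_ (Submodule.mem_map_of_mem hp)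
    rintro _ ⟨⟨h', v⟩, rfl⟩
    refine Submodule.subset_span ⟨(h * h', v), ?_⟩
    simp [ι_mul_word]
  have hWX : ∀ i, ∀ p ∈ W, (R.X i * p.1, R'.X i * p.2) ∈ W := by
    intro i p hp
    refine (Submodule.map_span_le ((LinearMap.mulLeft k (R.X i)).prodMap
      (LinearMap.mulLeft k (R'.X i))) _ W).mpr ?_ (Submodule.mem_map_of_mem hp)
    rintro _ ⟨⟨h', v⟩, rfl⟩
    simp only [LinearMap.prodMap_apply, LinearMap.mulLeft_apply, X_mul_word]
    exact Submodule.smul_mem W (E.χ i h' : k) (Submodule.subset_span ⟨(h', i :: v), rfl⟩)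
  -- The two skew Leibniz rules agree term by term, because contraction with `τ i` and `tw i` both
  -- fix monomials.
  have hWmon : ∀ i v, (contract (l i) (R.mon v), E.strip i (R'.mon v)) ∈ W := by
    intro i v
    induction v with
    | nil =>
      have h1 : contract (l i) (R.mon []) = 0 := by
        have := hl' i 1 [] (by simp)
        rw [mon_nil, contract_one]
        simpa [word] using congrArg (· • (1 : A)) this
      rw [h1, show E.strip i (R'.mon []) = 0 from strip_nil i 1]
      exact zero_mem W
    | cons j v ih =>
      rw [mon_cons, contract_mul_of_comul _ (hR.comul_X j), mon_cons]
      by_cases hj : j = i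
      · subst hj
        rw [hlX, hτmon, hR', coPathRealization_X, strip_arrow_mul, tw_mon, add_comm]
        have h1 : (R.word (E.g j) v, R'.word (E.g j) v) ∈ W :=
          Submodule.subset_span ⟨(E.g j, v), rfl⟩
        exact add_mem h1 (hWX j _ ih)
      · rw [hlX' i j hj, contract_zero, hR', coPathRealization_X, strip_arrow_mul_of_ne hj,
          LinearMap.zero_apply, mul_zero, add_zero]
        exact hWX j _ ih
  have hW : ∀ i, ∀ p ∈ W, (contract (l i) p.1, E.strip i p.2) ∈ W := by
    intro i p hp
    refine (Submodule.map_span_le ((contract (l i)).prodMap (E.strip i)) _ W).mpr ?_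
      (Submodule.mem_map_of_mem hp)
    rintro _ ⟨⟨h, v⟩, rfl⟩
    have h1 : contract (l i) (R.word h v) = R.ι h * contract (l i) (R.mon v) := by
      rw [word, contract_mul_of_isGroupLikeElem _ (hR.isGroupLikeElem_ι h), hlι]
    have h2 : E.strip i (R'.word h v) = R'.ι h * E.strip i (R'.mon v) :=
      strip_vertex_mul i h _
    rw [LinearMap.prodMap_apply, h1, h2]
    exact hWι h _ (hWmon i v)
  have hρW : ∀ x, ∀ p ∈ W, ρ x p.1 = E.coeff x [] p.2 := by
    intro x p hp
    refine sub_eq_zero.mp ((Submodule.span_le (p := LinearMap.ker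
      (ρ x ∘ₗ LinearMap.fst k A E.CoPath - E.coeff x [] ∘ₗ LinearMap.snd k A E.CoPath))).mpr ?_ hp)
    rintro _ ⟨⟨h, v⟩, rfl⟩
    change ρ x (R.word h v) - E.coeff x [] (R'.word h v) = 0
    rw [sub_eq_zero]
    by_cases hv : v = []
    · subst hv
      have h1 : R'.word h [] = E.path h [] := by simp [word, hR', coPathRealization_ι]
      rw [hρ, h1]
      by_cases hx : h = x
      · subst hx; simp [coeff_path_self]
      · rw [coeff_path_of_ne (by simp [hx])]; simp [hx]
    · rw [hρ' x h v hv, coeff_coPath_word]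
      exact fun h => hv (List.nil_perm.mp h.2)
  refine hg.exists_algHom R' fun p hp h0 => ?_
  -- Each strip on the second component is matched by a contraction on the first, which keeps it
  -- `0`, until only a vertex coefficient is left.
  have key : ∀ v x, ∀ p ∈ W, p.1 = 0 → E.coeff x v p.2 = 0 := by
    intro v
    induction v with
    | nil => intro x p hp h0; rw [← hρW x p hp, h0, map_zero]
    | cons i v ih =>
      intro x p hp h0
      rw [← coeff_strip]
      exact ih _ _ (hW i p hp) (by simp [h0])
  exact ext_coeff fun x v => by rw [key v x p hp h0, map_zero]

end Realization
end ToCoPath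
end ESC

namespace ESC

/-! ### The multiple Taft algebra, generated and graded by words. -/

section TaftWords
variable {k G J : Type*} [Field k] [Group G] {E : ESC k G J}

open Realization

/-- An algebra which embeds into the co-path Hopf algebra such that words go to words is graded by the
length of words. -/
lemma Realization.Generates.isInternal_deg_of_injective {B : Type*} [Ring B] [Algebra k B]
    {R : E.Realization B} (hg : R.Generates) (hE : E.IsQuantumWeaklyCommutative)
    (f : B →ₐ[k] E.CoPath) (hf : Function.Injective f) (hR : R.map f = coPathRealization hE) :
    DirectSum.IsInternal R.deg := by
  have hw : ∀ h v, f (R.word h v) = (coPathRealization hE).word h v := fun h v => by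
    rw [← map_word, hR]
  refine hg.isInternal_deg (fun n => E.lengthProj n ∘ₗ f.toLinearMap) (fun n h v hn => ?_)
    (fun n a ha h0 => ?_)
  · change E.lengthProj n (f (R.word h v)) = 0
    rw [hw, lengthProj_of_mem (coPath_word_mem_length h v), if_neg hn]
  · refine (injective_iff_map_eq_zero f).mp hf a ?_
    have h1 : f a ∈ (R.map f).deg n := by
      rw [map_deg]; exact Submodule.mem_map_of_mem ha
    have h2 : (R.map f).deg n ≤
        Submodule.span k {a : E.CoPath | ∃ x u, u.length = n ∧ a = E.path x u} := by
      rw [hR, deg, Submodule.span_le]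
      rintro _ ⟨h, v, rfl, rfl⟩
      exact coPath_word_mem_length h v
    have h3 := lengthProj_of_mem (n := n) (h2 h1)
    rw [if_pos rfl] at h3
    exact h3.symm.trans h0

variable (hE : E.IsQuantumWeaklyCommutative)

/-- The vertices and the arrows starting at `1`, in the multiple Taft algebra. -/
noncomputable def taftRealization : E.Realization E.Taft where
  ι :=
    { toFun := taftVertex
      map_one' := rfl
      map_mul' := fun x y => Subtype.ext ((coPathRealization hE).ι.map_mul x y) }
  X i := taftArrow 1 i
  X_mul_ι j h := Subtype.ext ((coPathRealization hE).X_mul_ι j h)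
  X_mul_X i j hij := Subtype.ext ((coPathRealization hE).X_mul_X i j hij)

lemma taftRealization_map : (taftRealization hE).map E.taft.val = coPathRealization hE := rfl

lemma val_taft_word (h : G) (v : List J) :
    E.taft.val ((taftRealization hE).word h v) = (coPathRealization hE).word h v := by
  rw [← map_word, taftRealization_map]

lemma isHopf_taft : (taftRealization hE).IsHopf where
  isGroupLikeElem_ι h :=
    { counit_eq_one := taftCounit_vertex h
      comul_eq_tmul_self := taftComul_vertex h }
  comul_X i := (taftComul_arrow 1 i).trans (by rw [mul_one]; rfl)

/-- The arrows starting at `1` are enough, since left multiplication by the vertex `x` moves such an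
arrow to start at `x`. -/
lemma generates_taft : (taftRealization hE).Generates := by
  rw [Generates, eq_top_iff]
  intro a _
  set S := Algebra.adjoin k (Set.range (taftRealization hE).ι ∪ Set.range (taftRealization hE).X)
  have hι : ∀ x, taftVertex x ∈ S := fun x => Algebra.subset_adjoin (Or.inl ⟨x, rfl⟩)
  have hX : ∀ i, taftArrow 1 i ∈ S := fun i => Algebra.subset_adjoin (Or.inr ⟨i, rfl⟩)
  have h : E.taft ≤ S.map E.taft.val := by
    refine Algebra.adjoin_le ?_
    rintro _ (⟨x, rfl⟩ | ⟨⟨x, i⟩, rfl⟩)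
    · exact ⟨_, hι x, rfl⟩
    · refine ⟨_, mul_mem (hι x) (hX i), ?_⟩
      change E.path x [] * E.path 1 [i] = E.path x [i]
      rw [vertex_mul_path, mul_one]
  obtain ⟨b, hb, hba⟩ := h a.2
  rwa [← Subtype.ext hba]

lemma isInternal_taft : DirectSum.IsInternal (taftRealization hE).deg :=
  (generates_taft hE).isInternal_deg_of_injective hE E.taft.val Subtype.val_injective
    (taftRealization_map hE)

lemma taftGrading_eq : E.taftGrading = (taftRealization hE).deg := by
  funext n
  refine le_antisymm (fun a ha => ?_) ?_
  -- Each word involves only paths of its own length, so the length projection of a combination of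
  -- words keeps exactly the words of length `n`. An element supported on paths of length `n` equals
  -- its own projection.
  · have h : ∀ a : E.Taft, ∃ b ∈ (taftRealization hE).deg n,
        E.taft.val b = E.lengthProj n (E.taft.val a) := by
      intro a
      have ha : a ∈ Submodule.span k
          (Set.range fun p : G × List J => (taftRealization hE).word p.1 p.2) := by
        rw [(generates_taft hE).span_word]; trivial
      induction ha using Submodule.span_induction with
      | mem a ha =>
        obtain ⟨⟨h, v⟩, rfl⟩ := ha
        rw [val_taft_word, lengthProj_of_mem (coPath_word_mem_length h v)]
        by_cases hv : v.length = n
        · exact ⟨_, hv ▸ word_mem_deg _ h v, by rw [if_pos hv, val_taft_word]⟩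
        · exact ⟨0, zero_mem _, by rw [if_neg hv, map_zero]⟩
      | zero => exact ⟨0, zero_mem _, by simp⟩
      | add a a' _ _ ha ha' =>
        obtain ⟨b, hb, hb'⟩ := ha
        obtain ⟨c, hc, hc'⟩ := ha'
        exact ⟨b + c, add_mem hb hc, by rw [map_add, hb', hc', map_add, map_add]⟩
      | smul r a _ ha =>
        obtain ⟨b, hb, hb'⟩ := ha
        exact ⟨r • b, Submodule.smul_mem _ _ hb, by rw [map_smul, hb', map_smul, map_smul]⟩
    obtain ⟨b, hb, hba⟩ := h a
    have h1 := lengthProj_of_mem (n := n) (Submodule.mem_comap.mp ha)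
    rw [if_pos rfl] at h1
    rwa [← show b = a from Subtype.ext (hba.trans h1)]
  · rw [deg, Submodule.span_le]
    rintro _ ⟨h, v, rfl, rfl⟩
    have h1 := coPath_word_mem_length (hE := hE) h v
    rw [← val_taft_word] at h1
    exact Submodule.mem_comap.mpr h1

end TaftWords

/-! ### The comparison map from `H` to the multiple Taft algebra. -/

section Isomorphism
variable {k G J : Type*} [Field k] [Group G] {E : ESC k G J} {A : Type*} [Ring A] [HopfAlgebra k A]
  (D : E.System A)

open Realization

namespace System

/-- The generators of a `System`. -/
def realization : E.Realization A := ⟨D.ι, D.X, D.X_mul_ι, D.X_mul_X⟩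

lemma isHopf_realization : D.realization.IsHopf := ⟨D.isGroupLikeElem_ι, D.comul_X⟩

lemma generates_realization : D.realization.Generates := D.adjoin_eq_top

/-- The generators of the quotient `D.H`. -/
noncomputable def realizationH : E.Realization D.H :=
  D.realization.map (Bialgebra.Quotient.mkBialgHom (R := k) D.ideal : A →ₐ[k] D.H)

lemma isHopf_realizationH : D.realizationH.IsHopf := D.isHopf_realization.map _

lemma generates_realizationH : D.realizationH.Generates :=
  D.generates_realization.map Ideal.Quotient.mk_surjective

lemma gradingH_eq : D.gradingH = D.realizationH.deg :=
  funext fun n => (D.realization.map_deg _ n).symm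

lemma realizationH_pow_eq_zero (i : J) (n : ℕ) (hn : (n : ℕ∞) = E.N i) :
    D.realizationH.X i ^ n = 0 := by
  change Ideal.Quotient.mk D.ideal (D.X i) ^ n = 0
  rw [← map_pow]
  exact Ideal.Quotient.eq_zero_iff_mem.mpr (TwoSidedIdeal.subset_span ⟨i, n, hn, rfl⟩)

variable {D}

/-- The map `A → kQᶜ` takes generators into the Taft subalgebra and kills each `X_i^{N_i}` by
`coPath_pow_eq_zero`, so it descends to the quotient. -/
lemma IsGraded.exists_algHom_taft (hD : D.IsGraded) (hE : E.IsQuantumWeaklyCommutative) :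
    ∃ f : D.H →ₐ[k] E.Taft, D.realizationH.map f = taftRealization hE := by
  obtain ⟨f, hf⟩ := D.isHopf_realization.exists_algHom_coPath D.generates_realization D.ι_injective
    D.linearIndependent_X hD hE
  have hι : ∀ h, f (D.ι h) = E.path h [] := fun h => by
    simpa [word, realization, coPathRealization_ι] using hf h []
  have hX : ∀ i, f (D.X i) = E.path 1 [i] := fun i => by
    simpa [word, realization, coPathRealization_X] using hf 1 [i]
  have hmem : ∀ a, f a ∈ E.taft := by
    refine fun a => D.generates_realization.induction (p := fun a => f a ∈ E.taft) ?_ ?_ ?_ ?_ ?_ a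
    · rw [map_one]; exact one_mem _
    · intro h a ha
      rw [map_mul]
      exact mul_mem ((hι h).symm ▸ (taftVertex h).2) ha
    · intro i a ha
      rw [map_mul]
      exact mul_mem ((hX i).symm ▸ (taftArrow 1 i).2) ha
    · intro a b ha hb; rw [map_add]; exact add_mem ha hb
    · intro c a ha; rw [map_smul]; exact E.taft.smul_mem ha c
  let g : A →ₐ[k] E.Taft := f.codRestrict E.taft hmem
  have hideal : D.ideal ≤ RingHom.ker g := by
    have h : TwoSidedIdeal.span D.powers ≤ TwoSidedIdeal.ker g := by
      rw [TwoSidedIdeal.span_le]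
      rintro _ ⟨i, n, hn, rfl⟩
      refine (TwoSidedIdeal.mem_ker _).mpr (Subtype.ext ?_)
      change f (D.X i ^ n) = 0
      rw [map_pow, hX]
      exact coPath_pow_eq_zero (hE := hE) hn
    exact fun a ha => (TwoSidedIdeal.mem_ker _).mp (h ha)
  refine ⟨Ideal.Quotient.liftₐ D.ideal g fun a ha => hideal ha, ?_⟩
  have h1 : ∀ h, g (D.ι h) = taftVertex h := fun h => Subtype.ext (hι h)
  have h2 : ∀ i, g (D.X i) = taftArrow 1 i := fun i => Subtype.ext (hX i)
  exact Realization.ext (MonoidHom.ext h1) (funext h2)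

/-- The reduced words span `H` and their images are independent, which gives injectivity.
Surjectivity holds because the generators of the Taft algebra are hit. -/
lemma bijective_of_map_eq_taftRealization (hE : E.IsQuantumWeaklyCommutative)
    (hk : ∀ i, E.χ i (E.g i) = 1 → CharZero k) {f : D.H →ₐ[k] E.Taft}
    (hf : D.realizationH.map f = taftRealization hE) : Function.Bijective f := by
  classical
  constructor
  · refine (injective_iff_map_eq_zero f).mpr fun a ha => ?_
    have h1 : a ∈ Submodule.span k (Set.range fun p : G × Reduced E =>
        D.realizationH.word p.1 (p.2 : Multiset J).toList) := by
      rw [D.generates_realizationH.span_reduced D.realizationH_pow_eq_zero]; trivial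
    obtain ⟨c, rfl⟩ := Finsupp.mem_span_range_iff_exists_finsupp.mp h1
    have h2 : c = 0 := by
      refine linearIndependent_iff.mp (coPath_linearIndependent (hE := hE) hk) c ?_
      have h3 := congrArg E.taft.val ha
      rw [map_finsuppSum, map_finsuppSum, map_zero] at h3
      rw [Finsupp.linearCombination_apply, ← h3]
      refine Finsupp.sum_congr fun p _ => ?_
      rw [map_smul, map_smul, ← map_word, hf, val_taft_word]
    rw [h2, Finsupp.sum_zero_index]
  · rw [← AlgHom.range_eq_top, eq_top_iff, ← show _ = _ from generates_taft hE, ← hf]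
    refine Algebra.adjoin_le ?_
    rintro _ (⟨h, rfl⟩ | ⟨i, rfl⟩)
    · exact ⟨_, rfl⟩
    · exact ⟨_, rfl⟩

end System
end Isomorphism

end ESC

/-! ### Conclusion. -/

theorem proposition3p8 {k : Type u} [Field k] {G : Type v} [Group G] {J : Type w}
    (E : ESC k G J) (hE : E.IsQuantumWeaklyCommutative)
    (hk : ∀ i, E.χ i (E.g i) = 1 → CharZero k) :
    (∃ (A : Type (max u v w)) (_ : Ring A) (_ : HopfAlgebra k A) (D : E.System A),
      D.IsPresented ∧ D.IsGraded) ∧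
    ∀ (A : Type x) [Ring A] [HopfAlgebra k A] (D : E.System A), D.IsGraded →
      ESC.IsGradedHopf k D.gradingH ∧ ESC.IsGradedHopf k E.taftGrading ∧
      ∃ e : D.H ≃ₐc[k] E.Taft,
        (∀ a, e (HopfAlgebra.antipode k a) = HopfAlgebra.antipode k (e a)) ∧
        ∀ n (a : D.H), a ∈ D.gradingH n ↔ e a ∈ E.taftGrading n := by
  refine ⟨?_, ?_⟩
  · let _ := E.presentedHopfAlgebra hE
    -- The homomorphism to `kQᶜ` defined by the relations provides injectivity on `G`, independence
    -- of the `X i` and the disjointness condition.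
    exact ⟨E.Presented, inferInstance, E.presentedHopfAlgebra hE,
      (ESC.isHopf_presented hE).system (ESC.Realization.generates_presented E)
        (ESC.coPathRealization hE).lift (ESC.Realization.lift_ι _) (ESC.Realization.lift_X _),
      ⟨ESC.Presented.equiv E, fun _ => rfl, fun _ => rfl⟩, ESC.isInternal_presented E⟩
  · intro A _ _ D hD
    obtain ⟨f, hf⟩ := hD.exists_algHom_taft hE
    have hbij := ESC.System.bijective_of_map_eq_taftRealization hE hk hf
    -- The images of the generators are again group-like and skew-primitive, so `f` respects the
    -- coalgebra structures.
    let φ : D.H →ₐc[k] E.Taft := D.isHopf_realizationH.bialgHom D.generates_realizationH f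
      (hf ▸ ESC.isHopf_taft hE)
    refine ⟨?_, ?_, BialgEquiv.ofBijective φ hbij, fun a => ?_, fun n a => ?_⟩
    · rw [D.gradingH_eq]
      -- `H` embeds into `kQᶜ` through the Taft algebra, so path length separates its degrees.
      refine D.isHopf_realizationH.isGradedHopf
        (D.generates_realizationH.isInternal_deg_of_injective hE (E.taft.val.comp f)
          (Subtype.val_injective.comp hbij.1) ?_)
      rw [← ESC.taftRealization_map, ← hf]
      rfl
    · rw [ESC.taftGrading_eq hE]
      exact (ESC.isHopf_taft hE).isGradedHopf (ESC.isInternal_taft hE)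
    · exact D.isHopf_realizationH.map_antipode D.generates_realizationH φ a
    -- The degree `n` part of the Taft algebra is the image under `f` of that of `H`, and
    -- injectivity of `f` gives the equivalence.
    · rw [D.gradingH_eq, ESC.taftGrading_eq hE, ← hf, ESC.Realization.map_deg]
      exact (hbij.1.mem_set_image (s := D.realizationH.deg n)).symm
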